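/- Let $n,k,d\in\mathbb N$, let $\Theta\subset\mathbb R^d$ be compact, and let $\mu$ be a Borel probability measure on $\Theta$. Let $F_0,F_1,\dots,F_k:\mathbb R^n\times\Theta\to\mathbb R^n$ satisfy, for some constant $L$, $$|F_i(x_1,\theta_1)-F_i(x_2,\theta_2)|_2\le L\big(|x_1-x_2|_2+|\theta_1-\theta_2|_2\big)\qquad(i=0,\dots,k)$$ for all $(x_1,\theta_1),(x_2,\theta_2)\in\mathbb R^n\times\Theta$; let $F=(F_1,\dots,F_k)$ be the $n\times k$ matrix field with columns $F_1,\dots,F_k$, and let $x_0:\Theta\to\mathbb R^n$ be continuous. For $u\in\mathcal U:=L^2([0,1],\mathbb R^k)$ and $\theta\in\Theta$, let $x_u^\theta:[0,1]\to\mathbb R^n$ be the absolutely continuous solution of $$\dot x(t)=F_0(x(t),\theta)+F(x(t),\theta)\,u(t)\ \text{ for a.e. } t\in[0,1],\qquad x(0)=x_0(\theta),$$ and put $X_u(t,\theta):=x_u^\theta(t)$. Let $\beta>0$, let $a:\mathbb R^n\times\Theta\to[0,\infty)$ be continuous, and let $$\mathcal F(u):=\int_\Theta a(x_u^\theta(1),\theta)\,d\mu(\theta)+\frac\beta2\|u\|_{L^2}^2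 ,\qquad u\in\mathcal U .$$ Assume that the partial derivatives $\frac{\partial F_i}{\partial x}$ ($i=0,\dots,k$) and the gradient $\nabla_x a$ exist and are continuous in $(x,\theta)\in\mathbb R^n\times\Theta$, and let $\bar u\in\mathcal U$ be a local minimizer of $\mathcal F$ with respect to the $L^2$-norm. Then all the trajectories $x_u^\theta$ exist and are unique; for every $\theta\in\Theta$ there is exactly one absolutely continuous curve of covectors (row vectors) $\Lambda_{\bar u}(\cdot,\theta):[0,1]\to(\mathbb R^n)^*$ with $$\partial_t\Lambda_{\bar u}(t,\theta)=-\Lambda_{\bar u}(t,\theta)\Big(\frac{\partial F_0}{\partial x}(X_{\bar u}(t,\theta),\theta)+\sum_{i=1}^k\bar u_i(t)\frac{\partial F_i}{\partial x}(X_{\bar u}(t,\theta),\theta)\Big)\ \text{ for a.e. } t\in[0,1],$$ $$\Lambda_{\bar u}(1,\theta)=\nabla_x a(X_{\bar u}(1,\theta),\theta);$$ all the integrals over $\Theta$ that are written here converge; and for a.e. $t\in[0,1]$ $$\bar u(t)\in\arg\max_{v\in\mathbb R^k}\Big\{\int_\Theta-\Lambda_{\bar u}(t,\theta)\,F(X_{\bar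 u}(t,\theta),\theta)\,v\,d\mu(\theta)-\frac\beta2|v|_2^2\Big\}.$$ Moreover, for every $t\in[0,1]$ the unique maximizer of this expression is $-\frac1\beta\int_\Theta\big[\Lambda_{\bar u}(t,\theta)F(X_{\bar u}(t,\theta),\theta)\big]^T d\mu(\theta)$, so that, equivalently, for a.e. $t\in[0,1]$ $$\bar u(t)=-\frac1\beta\int_\Theta\big[\Lambda_{\bar u}(t,\theta)\,F(X_{\bar u}(t,\theta),\theta)\big]^T d\mu(\theta).$$ -/

import Mathlib

open MeasureTheory Set

noncomputable section

namespace EnsembleControl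

/-- `ℝ^m` with its Euclidean norm. -/
abbrev Vec (m : ℕ) : Type := EuclideanSpace ℝ (Fin m)

/-- Covectors of `ℝ^m` (the row vectors of length `m`). -/
abbrev Covec (m : ℕ) : Type := Vec m →L[ℝ] ℝ

/-- Lebesgue measure on `[0,1]`. -/
abbrev timeMeasure : Measure ℝ := volume.restrict (Icc (0 : ℝ) 1)

/-- The Hilbert space `L²([0,1], ℝ^k)` of admissible controls. -/
abbrev Control (k : ℕ) : Type := Lp (Vec k) 2 timeMeasure

/-- The data of an ensemble of affine-control systems
`ẋ = F₀(x, θ) + ∑ i, uᵢ(t) Fᵢ(x, θ)`, `x(0) = x₀(θ)`, on `ℝ^n`, with parameters `θ ∈ Θ ⊆ ℝ^d`.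
`fields i` is the `i`-th column of the `n × k` matrix field `F`. -/
structure AffineEnsemble (n k : ℕ) {d : ℕ} (Θ : Set (Vec d)) where
  drift : Vec n → Θ → Vec n
  fields : Fin k → Vec n → Θ → Vec n
  initial : Θ → Vec n

namespace AffineEnsemble

variable {n k d : ℕ} {Θ : Set (Vec d)}

/-- The product `F(x, θ) v` of the matrix `F(x, θ)` with `v ∈ ℝ^k`. -/
def steer (S : AffineEnsemble n k Θ) (x : Vec n) (θ : Θ) (v : Vec k) : Vec n :=
  ∑ i, v i • S.fields i x θ

/-- The row vector `l F(x, θ)`, transposed: an element of `ℝ^k`. -/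
def rowTimesFields (S : AffineEnsemble n k Θ) (x : Vec n) (θ : Θ) (l : Covec n) : Vec k :=
  WithLp.toLp 2 fun i => l (S.fields i x θ)

/-- The Jacobian `∂F₀/∂x (x, θ) + ∑ i, vᵢ ∂Fᵢ/∂x (x, θ)`. -/
def jacobian (S : AffineEnsemble n k Θ) (x : Vec n) (θ : Θ) (v : Vec k) : Vec n →L[ℝ] Vec n :=
  fderiv ℝ (fun y => S.drift y θ) x + ∑ i, v i • fderiv ℝ (fun y => S.fields i y θ) x

/-- `x` is a (Carathéodory) solution on `[0,1]` of the Cauchy problem with parameter `θ` and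
control `u`: it is absolutely continuous, and solves the equation at almost every time. -/
def IsTrajectory (S : AffineEnsemble n k Θ) (u : Control k) (θ : Θ) (x : ℝ → Vec n) : Prop :=
  AbsolutelyContinuousOnInterval x 0 1 ∧
  x 0 = S.initial θ ∧
  ∀ᵐ t ∂timeMeasure, HasDerivAt x (S.drift (x t) θ + S.steer (x t) θ (u t)) t

/-- The trajectory `t ↦ x_u^θ(t) = X_u(t, θ)` on `[0,1]`: the solution of the Cauchy problem
with parameter `θ` and control `u`. -/
def trajectory (S : AffineEnsemble n k Θ) (u : Control k) (θ : Θ) : ℝ → Vec n :=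
  Classical.epsilon fun x => S.IsTrajectory u θ x

/-- `l` is a (Carathéodory) solution on `[0,1]` of the adjoint equation
`l̇ = - l (∂F₀/∂x + ∑ i, uᵢ ∂Fᵢ/∂x)` along `x_u^θ`, with `l(1) = ∇ₓ a(x_u^θ(1), θ)`. -/
def IsAdjoint (S : AffineEnsemble n k Θ) (a : Vec n → Θ → ℝ) (u : Control k) (θ : Θ)
    (l : ℝ → Covec n) : Prop :=
  AbsolutelyContinuousOnInterval l 0 1 ∧
  l 1 = fderiv ℝ (fun y => a y θ) (S.trajectory u θ 1) ∧
  ∀ᵐ t ∂timeMeasure,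
    HasDerivAt l (-((l t).comp (S.jacobian (S.trajectory u θ t) θ (u t)))) t

/-- The adjoint curve `t ↦ λ_u^θ(t) = Λ_u(t, θ)` on `[0,1]`. -/
def adjoint (S : AffineEnsemble n k Θ) (a : Vec n → Θ → ℝ) (u : Control k) (θ : Θ) :
    ℝ → Covec n :=
  Classical.epsilon fun l => S.IsAdjoint a u θ l

/-- The averaged end-point cost `∫ a(x_u^θ(1), θ) dμ(θ) + β/2 ‖u‖²`. -/
def cost (S : AffineEnsemble n k Θ) (a : Vec n → Θ → ℝ) (μ : Measure Θ) (β : ℝ)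
    (u : Control k) : ℝ :=
  ∫ θ, a (S.trajectory u θ 1) θ ∂μ + β / 2 * ‖u‖ ^ 2

/-- The function of `v` that is maximized at time `t`:
`∫ - Λ_u(t, θ) F(X_u(t, θ), θ) v dμ(θ) - β/2 |v|²`. -/
def hamiltonian (S : AffineEnsemble n k Θ) (a : Vec n → Θ → ℝ) (μ : Measure Θ) (β : ℝ)
    (u : Control k) (t : ℝ) (v : Vec k) : ℝ :=
  ∫ θ, -(S.adjoint a u θ t (S.steer (S.trajectory u θ t) θ v)) ∂μ - β / 2 * ‖v‖ ^ 2

/-- The vector `-(1/β) ∫ [Λ_u(t, θ) F(X_u(t, θ), θ)]ᵀ dμ(θ)` of `ℝ^k`. -/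
def feedback (S : AffineEnsemble n k Θ) (a : Vec n → Θ → ℝ) (μ : Measure Θ) (β : ℝ)
    (u : Control k) (t : ℝ) : Vec k :=
  -(1 / β) • ∫ θ, S.rowTimesFields (S.trajectory u θ t) θ (S.adjoint a u θ t) ∂μ

end AffineEnsemble

end EnsembleControl

end

open MeasureTheory Set Filter Topology Function Asymptotics
open scoped RealInnerProductSpace

namespace EnsembleControl

/-! ### Absolute continuity and the fundamental theorem of calculus -/

section AbsoluteContinuity

variable {X Y Z : Type*} [PseudoMetricSpace X] [PseudoMetricSpace Y] [PseudoMetricSpace Z]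
variable {E : Type*} [NormedAddCommGroup E] [NormedSpace ℝ E]

/-! The controls are unconstrained and the maximized function is a concave quadratic in `v`, so the
maximum principle is equivalent to stationarity: no needle variations are needed. Along each line `u
+ ε • v` the cost has derivative `⟪W, v⟫ + β ⟪u, v⟫` at `ε = 0`, with `W t = ∫ Λ F dμ`. At a local
minimizer this vanishes for all `v`, hence `W + β • u = 0` in `L²`, which is the feedback formula.
Completing the square shows that the feedback is the unique maximizer.

The derivative is computed without solving the linearized equation. Let `x` and `y` be the
trajectories of `u` and `u + ε • v`. Integrating by parts the pairing of `Λ` with `y - x`, which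
vanishes at time `0`, turns `∇a (y 1 - x 1)` into the integral of `Λ` applied to the velocity
increment minus its linear part in `y - x` (`adjoint_terminal_increment`). Grönwall gives `‖y - x‖ ≤
C |ε|` uniformly in time and parameter. Hence the integrand is dominated by an integrable function
times `|ε|`, and its derivative at `0` is `Λ F v`. Differentiation under the integral is used once
in time and once over `Θ`, and Fubini's theorem identifies the result with `⟪W, v⟫`.

The controls are only integrable in time, so the equations are treated as integral equations.
Existence comes from a contraction in an exponentially weighted norm, uniqueness from Grönwall's
inequality with an integrable coefficient. Solving one equation in the Banach space of continuous
functions on `Θ` gives joint continuity in time and parameter, from which the measurability and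
bounds over `Θ` follow. -/

theorem absolutelyContinuousOnInterval_of_dist_le {f : ℝ → X} {g : ℝ → Y} {h : ℝ → Z} {a b : ℝ}
    (K : ℝ) (hf : AbsolutelyContinuousOnInterval f a b)
    (hg : AbsolutelyContinuousOnInterval g a b)
    (hle : ∀ s ∈ uIcc a b, ∀ t ∈ uIcc a b,
      dist (h s) (h t) ≤ K * (dist (f s) (f t) + dist (g s) (g t))) :
    AbsolutelyContinuousOnInterval h a b := by
  unfold AbsolutelyContinuousOnInterval at hf hg ⊢
  apply squeeze_zero' ?_ ?_ (by simpa using (hf.add hg).const_mul K)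
  · exact Eventually.of_forall fun _ => Finset.sum_nonneg fun i _ => dist_nonneg
  · rw [eventually_inf_principal]
    filter_upwards with I hI
    rw [← Finset.sum_add_distrib, Finset.mul_sum]
    exact Finset.sum_le_sum fun i hi => hle _ (hI.1 i hi).1 _ (hI.1 i hi).2

/-- Reduces to the scalar case: the increments are dominated by those of the primitive of `‖g‖`. -/
theorem absolutelyContinuousOnInterval_integral {g : ℝ → E} {a b : ℝ}
    (hg : IntervalIntegrable g volume a b) :
    AbsolutelyContinuousOnInterval (fun t => ∫ s in a..t, g s) a b := by
  have hn := hg.norm.absolutelyContinuousOnInterval_intervalIntegral (left_mem_uIcc)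
  refine absolutelyContinuousOnInterval_of_dist_le 1 hn hn fun s hs t ht => ?_
  have h1 : ∀ r ∈ uIcc a b, IntervalIntegrable g volume a r := fun r hr =>
    hg.mono_set (uIcc_subset_uIcc left_mem_uIcc hr)
  rw [dist_comm, dist_eq_norm, dist_comm, Real.dist_eq,
    intervalIntegral.integral_interval_sub_left (h1 t ht) (h1 s hs),
    intervalIntegral.integral_interval_sub_left (h1 t ht).norm (h1 s hs).norm]
  have := intervalIntegral.norm_integral_le_abs_integral_norm (f := g) (a := s) (b := t)
    (μ := volume)
  linarith [abs_nonneg (∫ x in s..t, ‖g x‖)]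

variable [CompleteSpace E]

/-- The fundamental theorem of calculus for absolutely continuous vector-valued functions. -/
theorem absolutelyContinuous_and_ae_hasDerivAt_iff {x g : ℝ → E} {a b : ℝ} (hab : a ≤ b)
    (hg : IntervalIntegrable g volume a b) :
    (AbsolutelyContinuousOnInterval x a b ∧
      ∀ᵐ t ∂volume.restrict (Icc a b), HasDerivAt x (g t) t) ↔
    ∀ t ∈ Icc a b, x t = x a + ∫ s in a..t, g s := by
  have hI := hg.ae_hasDerivAt_integral
  rw [uIcc_of_le hab] at hI
  rw [ae_restrict_iff' measurableSet_Icc]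
  constructor
  · rintro ⟨hx, hd⟩
    obtain ⟨C, hC⟩ := (hx.sub
      (absolutelyContinuousOnInterval_integral hg)).const_of_ae_hasDerivAt_zero (by
        rw [uIcc_of_le hab]
        filter_upwards [hd, hI] with t h1 h2 ht
        simpa using (h1 ht).sub (h2 ht a (left_mem_Icc.2 hab)))
    rw [uIcc_of_le hab] at hC
    intro t ht
    have h1 := hC t ht
    have h2 := hC a (left_mem_Icc.2 hab)
    simp only [Pi.sub_apply, intervalIntegral.integral_same, sub_zero] at h1 h2
    rw [h2, ← h1]; abel
  · intro h
    constructor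
    · have hp := absolutelyContinuousOnInterval_integral hg
      refine absolutelyContinuousOnInterval_of_dist_le 1 hp hp fun s hs t ht => ?_
      rw [uIcc_of_le hab] at hs ht
      rw [h s hs, h t ht, dist_add_left]
      linarith [dist_nonneg (x := ∫ r in a..s, g r) (y := ∫ r in a..t, g r)]
    · have ha : ∀ᵐ t : ℝ, t ≠ a := by simp [ae_iff, measure_singleton]
      have hb : ∀ᵐ t : ℝ, t ≠ b := by simp [ae_iff, measure_singleton]
      filter_upwards [hI, ha, hb] with t h1 h2 h3 ht
      have h4 : Icc a b ∈ 𝓝 t :=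
        Icc_mem_nhds (lt_of_le_of_ne ht.1 (Ne.symm h2)) (lt_of_le_of_ne ht.2 h3)
      refine ((h1 ht a (left_mem_Icc.2 hab)).const_add (x a)).congr_of_eventuallyEq ?_
      filter_upwards [h4] with r hr using h r hr

end AbsoluteContinuity

/-! ### Grönwall's inequality with an integrable coefficient -/

section Gronwall

theorem integral_exp_const_mul {c t : ℝ} (hc : c ≠ 0) :
    ∫ s in (0 : ℝ)..t, Real.exp (c * s) = (Real.exp (c * t) - 1) / c := by
  rw [intervalIntegral.integral_comp_mul_left (fun s => Real.exp s) hc, integral_exp]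
  simp [div_eq_inv_mul]

/-- Split `ℓ` into its truncation at height `m` and a remainder. By dominated convergence the
remainder has integral below `1/4` for some `m`; the truncated part contributes at most `m / c`
times the exponential, which is below a quarter of it once `c ≥ 4 m`. The factor `1/2` serves both
Grönwall's inequality and the contraction for existence. -/
theorem exists_integral_mul_exp_le {ℓ : ℝ → ℝ} (hℓ : IntervalIntegrable ℓ volume 0 1)
    (h0 : ∀ s, 0 ≤ ℓ s) :
    ∃ c : ℝ, 0 ≤ c ∧ ∀ t ∈ Icc (0 : ℝ) 1,
      ∫ s in (0 : ℝ)..t, ℓ s * Real.exp (c * s) ≤ Real.exp (c * t) / 2 := by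
  have hlim : Tendsto (fun m : ℕ => ∫ s in (0 : ℝ)..1, (ℓ s - min (ℓ s) m)) atTop
      (𝓝 (∫ s in (0 : ℝ)..1, (0 : ℝ))) := by
    refine intervalIntegral.tendsto_integral_filter_of_dominated_convergence ℓ ?_ ?_ hℓ ?_
    · refine Eventually.of_forall fun m => ?_
      have := (intervalIntegrable_iff.1 hℓ).aestronglyMeasurable
      exact this.sub (this.inf aestronglyMeasurable_const)
    · refine Eventually.of_forall fun m => Eventually.of_forall fun s _ => ?_
      rw [Real.norm_of_nonneg (sub_nonneg.2 (min_le_left _ _))]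
      have : 0 ≤ min (ℓ s) m := le_min (h0 s) (Nat.cast_nonneg m)
      linarith
    · refine Eventually.of_forall fun s _ => tendsto_const_nhds.congr' ?_
      obtain ⟨N, hN⟩ := exists_nat_ge (ℓ s)
      filter_upwards [eventually_ge_atTop N] with m hm
      rw [min_eq_left (hN.trans (by exact_mod_cast hm)), sub_self]
  simp only [intervalIntegral.integral_zero] at hlim
  obtain ⟨m, hm⟩ := (hlim.eventually (gt_mem_nhds (show (0 : ℝ) < 1 / 4 by norm_num))).exists
  -- The summand `1` keeps `c` positive when `m = 0`.
  set c : ℝ := 4 * m + 1 with hc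
  have hm0 : (0 : ℝ) ≤ m := Nat.cast_nonneg m
  have hc0 : 0 < c := by positivity
  refine ⟨c, hc0.le, fun t ht => ?_⟩
  have hsub : uIcc (0 : ℝ) t ⊆ uIcc 0 1 := by
    rw [uIcc_of_le ht.1, uIcc_of_le zero_le_one]; exact Icc_subset_Icc_right ht.2
  have hr : IntervalIntegrable (fun s => ℓ s - min (ℓ s) m) volume 0 1 := by
    refine hℓ.mono_fun ?_ (Eventually.of_forall fun s => ?_)
    · have := (intervalIntegrable_iff.1 hℓ).aestronglyMeasurable
      exact this.sub (this.inf aestronglyMeasurable_const)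
    · dsimp only
      rw [Real.norm_of_nonneg (sub_nonneg.2 (min_le_left _ _)), Real.norm_of_nonneg (h0 s)]
      have : 0 ≤ min (ℓ s) m := le_min (h0 s) (Nat.cast_nonneg m)
      linarith
  have hrt := hr.mono_set hsub
  have hexp : Continuous fun s : ℝ => Real.exp (c * s) := by fun_prop
  calc ∫ s in (0 : ℝ)..t, ℓ s * Real.exp (c * s)
      ≤ ∫ s in (0 : ℝ)..t, (m * Real.exp (c * s) + (ℓ s - min (ℓ s) m) * Real.exp (c * t)) := by
        refine intervalIntegral.integral_mono_on ht.1
          ((hℓ.mono_set hsub).mul_continuousOn hexp.continuousOn)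
          (((hexp.const_mul _).intervalIntegrable _ _).add (hrt.mul_const _)) fun s hs => ?_
        have h1 : Real.exp (c * s) ≤ Real.exp (c * t) :=
          Real.exp_le_exp.2 (mul_le_mul_of_nonneg_left hs.2 hc0.le)
        have h2 : 0 ≤ ℓ s - min (ℓ s) m := sub_nonneg.2 (min_le_left _ _)
        have h3 : min (ℓ s) m ≤ m := min_le_right _ _
        nlinarith [Real.exp_pos (c * s), mul_le_mul_of_nonneg_left h1 h2,
          mul_le_mul_of_nonneg_right h3 (Real.exp_pos (c * s)).le]
    _ = m * ((Real.exp (c * t) - 1) / c) +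
          (∫ s in (0 : ℝ)..t, (ℓ s - min (ℓ s) m)) * Real.exp (c * t) := by
        rw [intervalIntegral.integral_add ((hexp.const_mul _).intervalIntegrable _ _)
          (hrt.mul_const _), intervalIntegral.integral_const_mul,
          intervalIntegral.integral_mul_const, integral_exp_const_mul hc0.ne']
    _ ≤ Real.exp (c * t) / 4 + 1 / 4 * Real.exp (c * t) := by
        have h4 : ∫ s in (0 : ℝ)..t, (ℓ s - min (ℓ s) m) ≤
            ∫ s in (0 : ℝ)..1, (ℓ s - min (ℓ s) m) :=
          intervalIntegral.integral_mono_interval le_rfl ht.1 ht.2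
            (Eventually.of_forall fun s => sub_nonneg.2 (min_le_left _ _)) hr
        have h5 : (m : ℝ) * ((Real.exp (c * t) - 1) / c) ≤ Real.exp (c * t) / 4 := by
          rw [← mul_div_assoc, div_le_div_iff₀ hc0 (by norm_num)]
          nlinarith [Real.exp_pos (c * t)]
        have h6 := mul_le_mul_of_nonneg_right (h4.trans hm.le) (Real.exp_pos (c * t)).le
        linarith
    _ = Real.exp (c * t) / 2 := by ring

/-- **Grönwall's inequality** with an integrable coefficient. -/
theorem exists_gronwall_constant {ℓ : ℝ → ℝ} (hℓ : IntervalIntegrable ℓ volume 0 1)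
    (h0 : ∀ s, 0 ≤ ℓ s) :
    ∃ K : ℝ, 0 ≤ K ∧ ∀ (φ : ℝ → ℝ) (C : ℝ), 0 ≤ C → ContinuousOn φ (Icc 0 1) →
      (∀ t ∈ Icc (0 : ℝ) 1, φ t ≤ C + ∫ s in (0 : ℝ)..t, ℓ s * φ s) →
      ∀ t ∈ Icc (0 : ℝ) 1, φ t ≤ K * C := by
  obtain ⟨c, hc0, hc⟩ := exists_integral_mul_exp_le hℓ h0
  refine ⟨2 * Real.exp c, by positivity, fun φ C hC hφ hle => ?_⟩
  -- At a maximum point of the weighted function, the hypothesis and the choice of `c` give `N ≤ C +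
  -- N / 2`.
  have hw : ContinuousOn (fun t => Real.exp (-(c * t)) * φ t) (Icc 0 1) :=
    (Continuous.continuousOn (by fun_prop)).mul hφ
  obtain ⟨t₀, ht₀, hmax⟩ := isCompact_Icc.exists_isMaxOn (nonempty_Icc.2 zero_le_one) hw
  set N := Real.exp (-(c * t₀)) * φ t₀ with hN
  have hφN : ∀ s ∈ Icc (0 : ℝ) 1, φ s ≤ N * Real.exp (c * s) := fun s hs => by
    have h1 : Real.exp (-(c * s)) * φ s ≤ N := hmax hs
    have h2 := mul_le_mul_of_nonneg_right h1 (Real.exp_pos (c * s)).le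
    have h3 : Real.exp (-(c * s)) * Real.exp (c * s) = 1 := by rw [← Real.exp_add]; simp
    calc φ s = Real.exp (-(c * s)) * φ s * Real.exp (c * s) := by
          linear_combination -(φ s) * h3
      _ ≤ _ := h2
  have hsub : ∀ t ∈ Icc (0 : ℝ) 1, Icc 0 t ⊆ Icc (0 : ℝ) 1 := fun t ht =>
    Icc_subset_Icc_right ht.2
  have hexp : Continuous fun s : ℝ => Real.exp (c * s) := by fun_prop
  have hℓt : IntervalIntegrable ℓ volume 0 t₀ := hℓ.mono_set (by
    rw [uIcc_of_le ht₀.1, uIcc_of_le zero_le_one]; exact hsub t₀ ht₀)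
  have hN2 : N ≤ 2 * C := by
    -- No sign is assumed on `φ`; the contrary assumption makes `N` positive, as the estimate
    -- requires.
    by_contra! hcon
    have hNpos : 0 < N := by linarith
    have h1 : ∫ s in (0 : ℝ)..t₀, ℓ s * φ s ≤ N * (Real.exp (c * t₀) / 2) := by
      calc ∫ s in (0 : ℝ)..t₀, ℓ s * φ s
          ≤ ∫ s in (0 : ℝ)..t₀, N * (ℓ s * Real.exp (c * s)) := by
            refine intervalIntegral.integral_mono_on ht₀.1 (hℓt.mul_continuousOn (by
              rw [uIcc_of_le ht₀.1]; exact hφ.mono (hsub t₀ ht₀)))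
              ((hℓt.mul_continuousOn hexp.continuousOn).const_mul _) fun s hs => ?_
            have := mul_le_mul_of_nonneg_left (hφN s (hsub t₀ ht₀ hs)) (h0 s)
            linarith
        _ ≤ _ := by
            rw [intervalIntegral.integral_const_mul]
            exact mul_le_mul_of_nonneg_left (hc t₀ ht₀) hNpos.le
    have h2 := (hle t₀ ht₀).trans (add_le_add_right h1 C)
    have h3 := mul_le_mul_of_nonneg_left h2 (Real.exp_pos (-(c * t₀))).le
    have h4 : Real.exp (-(c * t₀)) * Real.exp (c * t₀) = 1 := by rw [← Real.exp_add]; simp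
    have h5 : Real.exp (-(c * t₀)) ≤ 1 :=
      Real.exp_le_one_iff.2 (neg_nonpos.2 (mul_nonneg hc0 ht₀.1))
    have h6 : Real.exp (-(c * t₀)) * (C + N * (Real.exp (c * t₀) / 2)) =
      Real.exp (-(c * t₀)) * C + N / 2 := by linear_combination N / 2 * h4
    rw [h6] at h3
    have h7 := mul_le_mul_of_nonneg_right h5 hC
    linarith
  intro t ht
  have h1 : Real.exp (c * t) ≤ Real.exp c :=
    Real.exp_le_exp.2 (mul_le_of_le_one_right hc0 ht.2)
  calc φ t ≤ N * Real.exp (c * t) := hφN t ht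
    _ ≤ 2 * C * Real.exp (c * t) := mul_le_mul_of_nonneg_right hN2 (Real.exp_pos _).le
    _ ≤ 2 * C * Real.exp c := mul_le_mul_of_nonneg_left h1 (by positivity)
    _ = 2 * Real.exp c * C := by ring

end Gronwall

end EnsembleControl

namespace EnsembleControl

/-! ### Integral equations: stability, uniqueness, existence, continuous flows -/

section IntegralEquation

variable {E : Type*} [NormedAddCommGroup E] [NormedSpace ℝ E]

/-- Stability of solutions of an integral equation under a perturbation of the right-hand side. -/
theorem norm_sub_le_of_integral_equation {ℓ r : ℝ → ℝ} {K C : ℝ}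
    (hK : ∀ (φ : ℝ → ℝ) (C : ℝ), 0 ≤ C → ContinuousOn φ (Icc 0 1) →
      (∀ t ∈ Icc (0 : ℝ) 1, φ t ≤ C + ∫ s in (0 : ℝ)..t, ℓ s * φ s) →
      ∀ t ∈ Icc (0 : ℝ) 1, φ t ≤ K * C)
    (hℓ : IntervalIntegrable ℓ volume 0 1) (hr : IntervalIntegrable r volume 0 1)
    (hr0 : ∀ s, 0 ≤ r s) (hC : ∫ s in (0 : ℝ)..1, r s ≤ C)
    {x y f g : ℝ → E} (hx : ContinuousOn x (Icc 0 1)) (hy : ContinuousOn y (Icc 0 1))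
    (hf : IntervalIntegrable f volume 0 1) (hg : IntervalIntegrable g volume 0 1)
    (hxf : ∀ t ∈ Icc (0 : ℝ) 1, x t = x 0 + ∫ s in (0 : ℝ)..t, f s)
    (hyg : ∀ t ∈ Icc (0 : ℝ) 1, y t = y 0 + ∫ s in (0 : ℝ)..t, g s)
    (h0 : x 0 = y 0)
    (hfg : ∀ᵐ s ∂volume.restrict (Icc (0 : ℝ) 1), ‖f s - g s‖ ≤ ℓ s * ‖x s - y s‖ + r s) :
    ∀ t ∈ Icc (0 : ℝ) 1, ‖x t - y t‖ ≤ K * C := by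
  have hxy : ContinuousOn (fun t => ‖x t - y t‖) (Icc 0 1) := (hx.sub hy).norm
  have hrC : 0 ≤ C := (intervalIntegral.integral_nonneg zero_le_one fun s _ => hr0 s).trans hC
  refine hK _ C hrC hxy fun t ht => ?_
  have hsub : uIcc (0 : ℝ) t ⊆ uIcc 0 1 := by
    rw [uIcc_of_le ht.1, uIcc_of_le zero_le_one]; exact Icc_subset_Icc_right ht.2
  have hi : IntervalIntegrable (fun s => ℓ s * ‖x s - y s‖) volume 0 t :=
    (hℓ.mono_set hsub).mul_continuousOn (hxy.mono (by rwa [uIcc_of_le zero_le_one] at hsub))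
  have h1 : x t - y t = ∫ s in (0 : ℝ)..t, (f s - g s) := by
    rw [intervalIntegral.integral_sub (hf.mono_set hsub) (hg.mono_set hsub), hxf t ht, hyg t ht,
      h0]
    abel
  calc ‖x t - y t‖ ≤ ∫ s in (0 : ℝ)..t, (ℓ s * ‖x s - y s‖ + r s) := by
        rw [h1]
        refine intervalIntegral.norm_integral_le_of_norm_le ht.1 ?_ (hi.add (hr.mono_set hsub))
        filter_upwards [(ae_restrict_iff' measurableSet_Icc).1 hfg] with s hs hst
        exact hs ⟨hst.1.le, hst.2.trans ht.2⟩
    _ = (∫ s in (0 : ℝ)..t, ℓ s * ‖x s - y s‖) + ∫ s in (0 : ℝ)..t, r s :=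
        intervalIntegral.integral_add hi (hr.mono_set hsub)
    _ ≤ C + ∫ s in (0 : ℝ)..t, ℓ s * ‖x s - y s‖ := by
        have := intervalIntegral.integral_mono_interval le_rfl ht.1 ht.2
          (Eventually.of_forall hr0) hr
        linarith

theorem eqOn_of_integral_equation {ℓ : ℝ → ℝ} (hℓ : IntervalIntegrable ℓ volume 0 1)
    (hℓ0 : ∀ s, 0 ≤ ℓ s)
    {x y f g : ℝ → E} (hx : ContinuousOn x (Icc 0 1)) (hy : ContinuousOn y (Icc 0 1))
    (hf : IntervalIntegrable f volume 0 1) (hg : IntervalIntegrable g volume 0 1)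
    (hxf : ∀ t ∈ Icc (0 : ℝ) 1, x t = x 0 + ∫ s in (0 : ℝ)..t, f s)
    (hyg : ∀ t ∈ Icc (0 : ℝ) 1, y t = y 0 + ∫ s in (0 : ℝ)..t, g s)
    (h0 : x 0 = y 0)
    (hfg : ∀ᵐ s ∂volume.restrict (Icc (0 : ℝ) 1), ‖f s - g s‖ ≤ ℓ s * ‖x s - y s‖) :
    EqOn x y (Icc 0 1) := by
  obtain ⟨K, -, hK⟩ := exists_gronwall_constant hℓ hℓ0
  intro t ht
  have := norm_sub_le_of_integral_equation (r := fun _ => 0) (C := 0) hK hℓ (by simp)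
    (fun _ => le_rfl) (by simp) hx hy hf hg hxf hyg h0 (by simpa using hfg) t ht
  rw [mul_zero] at this
  exact sub_eq_zero.1 (norm_le_zero_iff.1 this)

variable [CompleteSpace E]

/-- Existence of Carathéodory solutions on `[0,1]`, for vector fields that are globally Lipschitz
with an integrable Lipschitz constant. -/
theorem exists_solution_integral_equation {f : ℝ → E → E} {ℓ : ℝ → ℝ}
    (hℓ : IntervalIntegrable ℓ volume 0 1) (hℓ0 : ∀ s, 0 ≤ ℓ s)
    (hf : ∀ x : ℝ → E, Continuous x → IntervalIntegrable (fun s => f s (x s)) volume 0 1)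
    (hlip : ∀ s x y, ‖f s x - f s y‖ ≤ ℓ s * ‖x - y‖) (x₀ : E) :
    ∃ x : ℝ → E, Continuous x ∧
      ∀ t ∈ Icc (0 : ℝ) 1, x t = x₀ + ∫ s in (0 : ℝ)..t, f s (x s) := by
  obtain ⟨c, hc0, hc⟩ := exists_integral_mul_exp_le hℓ hℓ0
  let I : Set ℝ := Icc (0 : ℝ) 1
  have h01 : (0 : ℝ) ≤ 1 := zero_le_one
  -- Substituting `x s = exp (c * s) • y s` makes the Picard operator a contraction for the plain
  -- sup norm, at once on all of `[0,1]`. The constant extension beyond `[0,1]` makes the curve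
  -- continuous on `ℝ`.
  let ext : C(I, E) → ℝ → E := fun y s => Real.exp (c * s) • IccExtend h01 y s
  have hext : ∀ y, Continuous (ext y) := fun y =>
    (Continuous.smul (by fun_prop) (y.continuous.Icc_extend' (h := h01)))
  have hsub : ∀ t : I, uIcc (0 : ℝ) t ⊆ uIcc 0 1 := fun t => by
    rw [uIcc_of_le t.2.1, uIcc_of_le zero_le_one]; exact Icc_subset_Icc_right t.2.2
  let Q : C(I, E) → C(I, E) := fun y =>
    ⟨fun t => Real.exp (-(c * t)) • (x₀ + ∫ s in (0 : ℝ)..t, f s (ext y s)), by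
      have h1 := (absolutelyContinuousOnInterval_integral (hf _ (hext y))).continuousOn
      rw [uIcc_of_le h01] at h1
      have h2 := continuousOn_iff_continuous_domRestrict.1 h1
      exact Continuous.smul (by fun_prop) (continuous_const.add h2)⟩
  have hQ : ContractingWith (1 / 2) Q := by
    refine ⟨by norm_num [← NNReal.coe_lt_coe], LipschitzWith.of_dist_le_mul fun y z => ?_⟩
    rw [ContinuousMap.dist_le (by positivity)]
    intro t
    have hfy := (hf _ (hext y)).mono_set (hsub t)
    have hfz := (hf _ (hext z)).mono_set (hsub t)
    have hint : IntervalIntegrable (fun s => ℓ s * Real.exp (c * s)) volume 0 t :=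
      (hℓ.mono_set (hsub t)).mul_continuousOn (Continuous.continuousOn (by fun_prop))
    have h1 : ‖(∫ s in (0 : ℝ)..t, f s (ext y s)) - ∫ s in (0 : ℝ)..t, f s (ext z s)‖ ≤
        Real.exp (c * t) / 2 * dist y z := by
      rw [← intervalIntegral.integral_sub hfy hfz]
      calc _ ≤ ∫ s in (0 : ℝ)..t, ℓ s * Real.exp (c * s) * dist y z := by
            refine intervalIntegral.norm_integral_le_of_norm_le t.2.1
              (Eventually.of_forall fun s hs => ?_) (hint.mul_const _)
            refine (hlip s _ _).trans ?_
            rw [mul_assoc]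
            refine mul_le_mul_of_nonneg_left ?_ (hℓ0 s)
            simp only [ext]
            rw [← smul_sub, norm_smul, Real.norm_of_nonneg (Real.exp_pos _).le]
            refine mul_le_mul_of_nonneg_left ?_ (Real.exp_pos _).le
            rw [← dist_eq_norm]
            exact ContinuousMap.dist_apply_le_dist _
        _ ≤ _ := by
            rw [intervalIntegral.integral_mul_const]
            exact mul_le_mul_of_nonneg_right (hc t t.2) dist_nonneg
    calc dist (Q y t) (Q z t)
        = Real.exp (-(c * t)) *
          ‖(∫ s in (0 : ℝ)..t, f s (ext y s)) - ∫ s in (0 : ℝ)..t, f s (ext z s)‖ := by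
          simp only [Q, ContinuousMap.coe_mk]
          rw [dist_eq_norm, ← smul_sub, norm_smul, Real.norm_of_nonneg (Real.exp_pos _).le,
            add_sub_add_left_eq_sub]
      _ ≤ Real.exp (-(c * t)) * (Real.exp (c * t) / 2 * dist y z) :=
          mul_le_mul_of_nonneg_left h1 (Real.exp_pos _).le
      _ = _ := by
          have h4 : Real.exp (-(c * t)) * Real.exp (c * t) = 1 := by rw [← Real.exp_add]; simp
          push_cast
          linear_combination (dist y z / 2) * h4
  obtain ⟨y, hy⟩ : ∃ y, Q y = y := ⟨_, hQ.fixedPoint_isFixedPt⟩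
  refine ⟨ext y, hext y, fun t ht => ?_⟩
  have h1 : ext y t = Real.exp (c * t) • Q y ⟨t, ht⟩ := by
    rw [hy]; simp only [ext]; rw [IccExtend_of_mem h01 _ ht]
  rw [h1]
  simp only [Q, ContinuousMap.coe_mk]
  rw [smul_smul, ← Real.exp_add]
  simp

end IntegralEquation

/-- Solutions of a family of control-affine equations, with parameters in a compact space, depend
continuously on time and on the parameter. -/
theorem exists_continuous_flow {ι T V : Type*} [Fintype ι] [TopologicalSpace T] [CompactSpace T]
    [LocallyCompactSpace T]
    [NormedAddCommGroup V] [NormedSpace ℝ V] [CompleteSpace V] {c : ι → ℝ → ℝ}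
    (hc : ∀ i, IntervalIntegrable (c i) volume 0 1) {G : ι → ℝ → V → T → V}
    (hG : ∀ i, Continuous fun p : ℝ × V × T => G i p.1 p.2.1 p.2.2) {K : ℝ} (hK0 : 0 ≤ K)
    (hK : ∀ i t x y θ, ‖G i t x θ - G i t y θ‖ ≤ K * ‖x - y‖)
    {x₀ : T → V} (hx₀ : Continuous x₀) :
    ∃ X : ℝ → T → V, Continuous (uncurry X) ∧
      ∀ θ, ∀ t ∈ Icc (0 : ℝ) 1,
        X t θ = x₀ θ + ∫ s in (0 : ℝ)..t, ∑ i, c i s • G i s (X s θ) θ := by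
  -- The family is read as a single equation in `C(T, V)` driven by superposition operators. A
  -- continuous curve in `C(T, V)` is a jointly continuous function; evaluation at `θ`, a continuous
  -- linear map, recovers each equation.
  let N : ι → ℝ → C(T, V) → C(T, V) := fun i s ξ =>
    ⟨fun θ => G i s (ξ θ) θ, (hG i).comp (by fun_prop : Continuous fun θ => (s, ξ θ, θ))⟩
  have hN : ∀ i (ξ : ℝ → C(T, V)), Continuous ξ → Continuous fun s => N i s (ξ s) := by
    intro i ξ hξ
    have h1 : Continuous fun p : ℝ × T => ξ p.1 p.2 :=
      ContinuousMap.continuous_uncurry_of_continuous ⟨ξ, hξ⟩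
    exact (ContinuousMap.curry ⟨fun p : ℝ × T => G i p.1 (ξ p.1 p.2) p.2,
      (hG i).comp (continuous_fst.prodMk (h1.prodMk continuous_snd))⟩).continuous
  have hint : ∀ (ξ : ℝ → C(T, V)), Continuous ξ →
      IntervalIntegrable (fun s => ∑ i, c i s • N i s (ξ s)) volume 0 1 := by
    intro ξ hξ
    have := IntervalIntegrable.sum (μ := volume) (a := 0) (b := 1) Finset.univ
      (f := fun i s => c i s • N i s (ξ s))
      fun i _ => (hc i).smul_continuousOn (hN i ξ hξ).continuousOn
    simpa [Finset.sum_fn] using this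
  obtain ⟨x, hx, hxe⟩ := exists_solution_integral_equation
    (f := fun s ξ => ∑ i, c i s • N i s ξ) (ℓ := fun s => ∑ i, |c i s| * K)
    (by
      have := IntervalIntegrable.sum (μ := volume) (a := 0) (b := 1) Finset.univ
        (f := fun i s => |c i s| * K) fun i _ => (hc i).abs.mul_const K
      simpa [Finset.sum_fn] using this)
    (fun s => Finset.sum_nonneg fun i _ => by positivity)
    hint
    (fun s ξ η => by
      rw [← Finset.sum_sub_distrib, Finset.sum_mul]
      refine norm_sum_le_of_le _ fun i _ => ?_
      rw [← smul_sub, norm_smul, Real.norm_eq_abs, mul_assoc]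
      refine mul_le_mul_of_nonneg_left ?_ (abs_nonneg _)
      rw [ContinuousMap.norm_le _ (by positivity)]
      intro θ
      refine (hK i s (ξ θ) (η θ) θ).trans (mul_le_mul_of_nonneg_left ?_ hK0)
      exact ContinuousMap.norm_coe_le_norm (ξ - η) θ)
    ⟨x₀, hx₀⟩
  refine ⟨fun t θ => x t θ, ContinuousMap.continuous_uncurry_of_continuous ⟨x, hx⟩,
    fun θ t ht => ?_⟩
  have hsub : uIcc (0 : ℝ) t ⊆ uIcc 0 1 := by
    rw [uIcc_of_le ht.1, uIcc_of_le zero_le_one]; exact Icc_subset_Icc_right ht.2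
  have h1 := congrArg (ContinuousMap.evalCLM ℝ θ) (hxe t ht)
  rw [map_add, ← ContinuousLinearMap.intervalIntegral_comp_comm _ ((hint x hx).mono_set hsub)]
    at h1
  simpa [N] using h1

end EnsembleControl

/-! ### Trajectories and adjoint curves: existence, uniqueness, joint continuity -/

namespace EnsembleControl

theorem Control.intervalIntegrable {k : ℕ} (u : Control k) : IntervalIntegrable u volume 0 1 := by
  rw [intervalIntegrable_iff_integrableOn_Icc_of_le zero_le_one]
  exact (Lp.memLp u).integrable (by norm_num)

/-- Time reversal of an integral equation on `[0,1]`. -/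
theorem integral_equation_reverse {E : Type*} [NormedAddCommGroup E] [NormedSpace ℝ E]
    {x g : ℝ → E} (hg : IntervalIntegrable g volume 0 1)
    (h : ∀ t ∈ Icc (0 : ℝ) 1, x t = x 0 + ∫ s in (0 : ℝ)..t, g s) :
    ∀ t ∈ Icc (0 : ℝ) 1, x (1 - t) = x 1 + ∫ s in (0 : ℝ)..t, -g (1 - s) := by
  intro t ht
  have ht' : 1 - t ∈ Icc (0 : ℝ) 1 := ⟨by linarith [ht.2], by linarith [ht.1]⟩
  have h1 : uIcc (0 : ℝ) (1 - t) ⊆ uIcc 0 1 := by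
    rw [uIcc_of_le ht'.1, uIcc_of_le zero_le_one]; exact Icc_subset_Icc_right ht'.2
  rw [h _ ht', h 1 (right_mem_Icc.2 zero_le_one), intervalIntegral.integral_neg,
    intervalIntegral.integral_comp_sub_left (fun s => g s) 1, sub_zero,
    ← intervalIntegral.integral_interval_sub_left hg (hg.mono_set h1)]
  abel

namespace AffineEnsemble

variable {n k d : ℕ} {Θ : Set (Vec d)}

/-- The drift and the columns of the matrix field, as one family. -/
def column (S : AffineEnsemble n k Θ) : Option (Fin k) → Vec n → Θ → Vec n
  | none => S.drift
  | some i => S.fields i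

/-- The coefficients of the drift and of the columns of the matrix field. -/
def weight (v : Vec k) : Option (Fin k) → ℝ
  | none => 1
  | some i => v i

/-- The right-hand side of the controlled equation. -/
def velocity (S : AffineEnsemble n k Θ) (x : Vec n) (θ : Θ) (v : Vec k) : Vec n :=
  S.drift x θ + S.steer x θ v

/-- All the vector fields of the ensemble are Lipschitz in `(x, θ)` with constant `L`. -/
structure LipschitzFields (S : AffineEnsemble n k Θ) (L : ℝ) : Prop where
  nonneg : 0 ≤ L
  le : ∀ o x₁ x₂ θ₁ θ₂, ‖S.column o x₁ θ₁ - S.column o x₂ θ₂‖ ≤ L * (‖x₁ - x₂‖ + dist θ₁ θ₂)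

theorem velocity_eq_sum (S : AffineEnsemble n k Θ) (x : Vec n) (θ : Θ) (v : Vec k) :
    S.velocity x θ v = ∑ o, weight v o • S.column o x θ := by
  simp [velocity, steer, weight, column, Fintype.sum_option]

theorem jacobian_eq_sum (S : AffineEnsemble n k Θ) (x : Vec n) (θ : Θ) (v : Vec k) :
    S.jacobian x θ v = ∑ o, weight v o • fderiv ℝ (fun y => S.column o y θ) x := by
  simp [jacobian, weight, column, Fintype.sum_option]

theorem abs_weight_le (v : Vec k) (o : Option (Fin k)) : |weight v o| ≤ 1 + ‖v‖ := by
  cases o with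
  | none => simp [weight]
  | some i =>
    have : |v i| ≤ ‖v‖ := PiLp.norm_apply_le v i
    simp only [weight]
    linarith

theorem intervalIntegrable_weight {u : ℝ → Vec k} (hu : IntervalIntegrable u volume 0 1)
    (o : Option (Fin k)) : IntervalIntegrable (fun s => weight (u s) o) volume 0 1 := by
  cases o with
  | none => simp [weight]
  | some i =>
    simp only [weight]
    rw [intervalIntegrable_iff] at hu ⊢
    exact (EuclideanSpace.proj (𝕜 := ℝ) i).integrable_comp hu

theorem intervalIntegrable_sum_weight_smul {E : Type*} [NormedAddCommGroup E] [NormedSpace ℝ E]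
    {u : ℝ → Vec k} (hu : IntervalIntegrable u volume 0 1) {g : Option (Fin k) → ℝ → E}
    (hg : ∀ o, ContinuousOn (g o) (Icc 0 1)) :
    IntervalIntegrable (fun s => ∑ o, weight (u s) o • g o s) volume 0 1 := by
  have := IntervalIntegrable.sum (μ := volume) (a := 0) (b := 1) Finset.univ
    (f := fun o s => weight (u s) o • g o s)
    fun o _ => (intervalIntegrable_weight hu o).smul_continuousOn
      (by rw [uIcc_of_le zero_le_one]; exact hg o)
  simpa [Finset.sum_fn] using this

theorem norm_sum_weight_smul_le {E : Type*} [NormedAddCommGroup E] [NormedSpace ℝ E]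
    (v : Vec k) {g : Option (Fin k) → E} {C : ℝ} (hg : ∀ o, ‖g o‖ ≤ C) :
    ‖∑ o, weight v o • g o‖ ≤ (k + 1) * (1 + ‖v‖) * C := by
  have h1 : ‖∑ o, weight v o • g o‖ ≤ ∑ _o : Option (Fin k), (1 + ‖v‖) * C := by
    refine norm_sum_le_of_le _ fun o _ => ?_
    rw [norm_smul, Real.norm_eq_abs]
    exact mul_le_mul (abs_weight_le v o) (hg o) (norm_nonneg _) (by positivity)
  simpa [mul_assoc] using h1

section Lipschitz

variable {S : AffineEnsemble n k Θ} {L : ℝ} (hS : S.LipschitzFields L)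
include hS

theorem LipschitzFields.le_state (o : Option (Fin k)) (x y : Vec n) (θ : Θ) :
    ‖S.column o x θ - S.column o y θ‖ ≤ L * ‖x - y‖ := by
  simpa using hS.le o x y θ θ

theorem LipschitzFields.continuous (o : Option (Fin k)) :
    Continuous fun p : Vec n × Θ => S.column o p.1 p.2 := by
  refine (LipschitzWith.of_dist_le_mul (K := (2 * L).toNNReal) fun p q => ?_).continuous
  rw [Real.coe_toNNReal _ (by linarith [hS.nonneg]), dist_eq_norm]
  refine (hS.le o _ _ _ _).trans ?_
  have h1 : ‖p.1 - q.1‖ ≤ dist p q := by rw [← dist_eq_norm]; exact le_max_left _ _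
  have h2 : dist p.2 q.2 ≤ dist p q := le_max_right _ _
  nlinarith [hS.nonneg]

/-- The bound is uniform in state and parameter, so the adjoint equation is linear with an
integrable coefficient bound common to all `θ`. -/
theorem LipschitzFields.norm_fderiv_le (o : Option (Fin k)) (x : Vec n) (θ : Θ) :
    ‖fderiv ℝ (fun y => S.column o y θ) x‖ ≤ L := by
  have h : LipschitzWith L.toNNReal fun y => S.column o y θ :=
    LipschitzWith.of_dist_le_mul fun x y => by
      rw [Real.coe_toNNReal _ hS.nonneg, dist_eq_norm, dist_eq_norm]
      exact hS.le_state o x y θ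
  simpa [Real.coe_toNNReal _ hS.nonneg] using norm_fderiv_le_of_lipschitz ℝ h (x₀ := x)

theorem LipschitzFields.norm_jacobian_le (x : Vec n) (θ : Θ) (v : Vec k) :
    ‖S.jacobian x θ v‖ ≤ (k + 1) * (1 + ‖v‖) * L := by
  rw [jacobian_eq_sum]
  exact norm_sum_weight_smul_le v fun o => hS.norm_fderiv_le o x θ

theorem LipschitzFields.norm_velocity_sub_le (x y : Vec n) (θ : Θ) (v : Vec k) :
    ‖S.velocity x θ v - S.velocity y θ v‖ ≤ (k + 1) * (1 + ‖v‖) * L * ‖x - y‖ := by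
  rw [velocity_eq_sum, velocity_eq_sum, ← Finset.sum_sub_distrib]
  simp_rw [← smul_sub]
  rw [mul_assoc _ L]
  exact norm_sum_weight_smul_le v fun o => hS.le_state o x y θ

theorem LipschitzFields.intervalIntegrable_velocity {u : ℝ → Vec k}
    (hu : IntervalIntegrable u volume 0 1) {x : ℝ → Vec n} (hx : ContinuousOn x (Icc 0 1))
    (θ : Θ) : IntervalIntegrable (fun s => S.velocity (x s) θ (u s)) volume 0 1 := by
  simp_rw [velocity_eq_sum]
  exact intervalIntegrable_sum_weight_smul hu fun o =>
    (hS.continuous o).comp_continuousOn (hx.prodMk continuousOn_const)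

omit hS in
theorem intervalIntegrable_growth {u : ℝ → Vec k} (hu : IntervalIntegrable u volume 0 1)
    (C : ℝ) : IntervalIntegrable (fun s => (k + 1) * (1 + ‖u s‖) * C) volume 0 1 :=
  ((intervalIntegrable_const.add hu.norm).const_mul _).mul_const _

/-- The velocity is integrable along any continuous curve, so the fundamental theorem of calculus
applies and continuity is all that has to be asked of `x`. -/
theorem LipschitzFields.isTrajectory_iff (u : Control k) (θ : Θ) (x : ℝ → Vec n) :
    S.IsTrajectory u θ x ↔ ContinuousOn x (Icc 0 1) ∧ x 0 = S.initial θ ∧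
      ∀ t ∈ Icc (0 : ℝ) 1, x t = x 0 + ∫ s in (0 : ℝ)..t, S.velocity (x s) θ (u s) := by
  constructor
  · rintro ⟨h1, h2, h3⟩
    have hx : ContinuousOn x (Icc 0 1) := by
      simpa [uIcc_of_le (zero_le_one (α := ℝ))] using h1.continuousOn
    exact ⟨hx, h2, (absolutelyContinuous_and_ae_hasDerivAt_iff zero_le_one
      (hS.intervalIntegrable_velocity u.intervalIntegrable hx θ)).1 ⟨h1, h3⟩⟩
  · rintro ⟨hx, h2, h3⟩
    obtain ⟨h4, h5⟩ := (absolutelyContinuous_and_ae_hasDerivAt_iff zero_le_one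
      (hS.intervalIntegrable_velocity u.intervalIntegrable hx θ)).2 h3
    exact ⟨h4, h2, h5⟩

theorem LipschitzFields.isTrajectory_eqOn {u : Control k} {θ : Θ} {x y : ℝ → Vec n}
    (hx : S.IsTrajectory u θ x) (hy : S.IsTrajectory u θ y) : EqOn x y (Icc 0 1) := by
  obtain ⟨hx1, hx2, hx3⟩ := (hS.isTrajectory_iff u θ x).1 hx
  obtain ⟨hy1, hy2, hy3⟩ := (hS.isTrajectory_iff u θ y).1 hy
  exact eqOn_of_integral_equation (intervalIntegrable_growth u.intervalIntegrable L)
    (fun s => mul_nonneg (by positivity) hS.nonneg) hx1 hy1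
    (hS.intervalIntegrable_velocity u.intervalIntegrable hx1 θ)
    (hS.intervalIntegrable_velocity u.intervalIntegrable hy1 θ) hx3 hy3 (hx2.trans hy2.symm)
    (Eventually.of_forall fun s => hS.norm_velocity_sub_le _ _ θ _)

theorem LipschitzFields.exists_continuous_isTrajectory [CompactSpace Θ]
    (hinit : Continuous S.initial) (u : Control k) :
    ∃ X : ℝ → Θ → Vec n, Continuous (uncurry X) ∧ ∀ θ, S.IsTrajectory u θ fun t => X t θ := by
  obtain ⟨X, hX, hXe⟩ := exists_continuous_flow (G := fun o _ x θ => S.column o x θ)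
    (intervalIntegrable_weight u.intervalIntegrable)
    (fun o => (hS.continuous o).comp continuous_snd) hS.nonneg
    (fun o _ x y θ => hS.le_state o x y θ) hinit
  refine ⟨X, hX, fun θ => (hS.isTrajectory_iff u θ _).2 ⟨?_, ?_, fun t ht => ?_⟩⟩
  · exact (hX.comp (by fun_prop : Continuous fun t : ℝ => (t, θ))).continuousOn
  · simpa using hXe θ 0 (left_mem_Icc.2 zero_le_one)
  · have h0 := hXe θ 0 (left_mem_Icc.2 zero_le_one)
    simp only [intervalIntegral.integral_same, add_zero] at h0
    rw [h0]
    simp_rw [velocity_eq_sum]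
    exact hXe θ t ht

theorem LipschitzFields.isTrajectory_trajectory [CompactSpace Θ] (hinit : Continuous S.initial)
    (u : Control k) (θ : Θ) : S.IsTrajectory u θ (S.trajectory u θ) := by
  obtain ⟨X, -, hX⟩ := hS.exists_continuous_isTrajectory hinit u
  exact Classical.epsilon_spec (p := fun x => S.IsTrajectory u θ x) ⟨_, hX θ⟩

/-- `trajectory` is chosen separately for each `θ`, so its definition gives no regularity in `θ`.
Uniqueness identifies it on `[0,1]` with a continuous flow, through which continuity and compactness
arguments pass. -/
theorem LipschitzFields.exists_continuous_eq_trajectory [CompactSpace Θ]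
    (hinit : Continuous S.initial) (u : Control k) :
    ∃ X : ℝ → Θ → Vec n, Continuous (uncurry X) ∧
      ∀ θ, ∀ t ∈ Icc (0 : ℝ) 1, S.trajectory u θ t = X t θ := by
  obtain ⟨X, hXc, hX⟩ := hS.exists_continuous_isTrajectory hinit u
  exact ⟨X, hXc, fun θ => hS.isTrajectory_eqOn (hS.isTrajectory_trajectory hinit u θ) (hX θ)⟩

omit hS in
theorem intervalIntegrable_adjoint_rhs {u : ℝ → Vec k}
    (hu : IntervalIntegrable u volume 0 1) (θ : Θ)
    (hC1 : ∀ o, Continuous fun p : Vec n × Θ => fderiv ℝ (fun y => S.column o y p.2) p.1)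
    {x : ℝ → Vec n} (hx : ContinuousOn x (Icc 0 1))
    {l : ℝ → Covec n} (hl : ContinuousOn l (Icc 0 1)) :
    IntervalIntegrable (fun s => -((l s).comp (S.jacobian (x s) θ (u s)))) volume 0 1 := by
  have h : ∀ s, -((l s).comp (S.jacobian (x s) θ (u s))) =
      ∑ o, weight (u s) o • -((l s).comp (fderiv ℝ (fun y => S.column o y θ) (x s))) := by
    intro s
    rw [jacobian_eq_sum, ContinuousLinearMap.comp_finsetSum, ← Finset.sum_neg_distrib]
    simp
  simp_rw [h]
  exact intervalIntegrable_sum_weight_smul hu fun o => (hl.clm_comp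
    ((hC1 o).comp_continuousOn (hx.prodMk continuousOn_const))).neg

omit hS in
theorem isAdjoint_iff {a : Vec n → Θ → ℝ}
    (hC1 : ∀ o, Continuous fun p : Vec n × Θ => fderiv ℝ (fun y => S.column o y p.2) p.1)
    {u : Control k} {θ : Θ} (hx : ContinuousOn (S.trajectory u θ) (Icc 0 1)) (l : ℝ → Covec n) :
    S.IsAdjoint a u θ l ↔ ContinuousOn l (Icc 0 1) ∧
      l 1 = fderiv ℝ (fun y => a y θ) (S.trajectory u θ 1) ∧
      ∀ t ∈ Icc (0 : ℝ) 1, l t = l 0 +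
        ∫ s in (0 : ℝ)..t, -((l s).comp (S.jacobian (S.trajectory u θ s) θ (u s))) := by
  constructor
  · rintro ⟨h1, h2, h3⟩
    have hl : ContinuousOn l (Icc 0 1) := by
      simpa [uIcc_of_le (zero_le_one (α := ℝ))] using h1.continuousOn
    exact ⟨hl, h2, (absolutelyContinuous_and_ae_hasDerivAt_iff zero_le_one
      (intervalIntegrable_adjoint_rhs u.intervalIntegrable θ hC1 hx hl)).1 ⟨h1, h3⟩⟩
  · rintro ⟨hl, h2, h3⟩
    obtain ⟨h4, h5⟩ := (absolutelyContinuous_and_ae_hasDerivAt_iff zero_le_one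
      (intervalIntegrable_adjoint_rhs u.intervalIntegrable θ hC1 hx hl)).2 h3
    exact ⟨h4, h2, h5⟩

omit hS in
theorem continuousOn_comp_one_sub {E : Type*} [TopologicalSpace E] {l : ℝ → E}
    (hl : ContinuousOn l (Icc 0 1)) : ContinuousOn (fun t => l (1 - t)) (Icc 0 1) :=
  hl.comp (by fun_prop) fun t ht => ⟨by linarith [ht.2], by linarith [ht.1]⟩

omit hS in
theorem intervalIntegrable_comp_one_sub {E : Type*} [NormedAddCommGroup E] {g : ℝ → E}
    (hg : IntervalIntegrable g volume 0 1) :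
    IntervalIntegrable (fun t => g (1 - t)) volume 0 1 := by
  simpa using (hg.comp_sub_left 1).symm

/-- Reversing time turns the terminal condition into an initial one, to which Grönwall uniqueness
applies. -/
theorem LipschitzFields.isAdjoint_eqOn {a : Vec n → Θ → ℝ}
    (hC1 : ∀ o, Continuous fun p : Vec n × Θ => fderiv ℝ (fun y => S.column o y p.2) p.1)
    {u : Control k} {θ : Θ} (hx : ContinuousOn (S.trajectory u θ) (Icc 0 1)) {l m : ℝ → Covec n}
    (hl : S.IsAdjoint a u θ l) (hm : S.IsAdjoint a u θ m) : EqOn l m (Icc 0 1) := by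
  obtain ⟨hl1, hl2, hl3⟩ := (isAdjoint_iff hC1 hx l).1 hl
  obtain ⟨hm1, hm2, hm3⟩ := (isAdjoint_iff hC1 hx m).1 hm
  have hil := intervalIntegrable_adjoint_rhs u.intervalIntegrable θ hC1 hx hl1
  have him := intervalIntegrable_adjoint_rhs u.intervalIntegrable θ hC1 hx hm1
  have key := eqOn_of_integral_equation
    (intervalIntegrable_comp_one_sub (intervalIntegrable_growth u.intervalIntegrable L))
    (fun s => mul_nonneg (by positivity) hS.nonneg)
    (continuousOn_comp_one_sub hl1) (continuousOn_comp_one_sub hm1)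
    (intervalIntegrable_comp_one_sub hil).neg (intervalIntegrable_comp_one_sub him).neg
    (by simpa using integral_equation_reverse hil hl3)
    (by simpa using integral_equation_reverse him hm3)
    (by simp [hl2, hm2])
    (Eventually.of_forall fun s => by
      simp only [Pi.neg_apply, neg_neg]
      rw [← ContinuousLinearMap.sub_comp, mul_comm _ ‖_‖]
      exact (ContinuousLinearMap.opNorm_comp_le _ _).trans
        (mul_le_mul_of_nonneg_left (hS.norm_jacobian_le _ _ _) (norm_nonneg _)))
  intro t ht
  simpa using key (show 1 - t ∈ Icc (0 : ℝ) 1 from ⟨by linarith [ht.2], by linarith [ht.1]⟩)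

theorem LipschitzFields.exists_continuous_isAdjoint [CompactSpace Θ]
    (hinit : Continuous S.initial) {a : Vec n → Θ → ℝ}
    (hC1 : ∀ o, Continuous fun p : Vec n × Θ => fderiv ℝ (fun y => S.column o y p.2) p.1)
    (ha : Continuous fun p : Vec n × Θ => fderiv ℝ (fun x => a x p.2) p.1) (u : Control k) :
    ∃ Λ : ℝ → Θ → Covec n, Continuous (uncurry Λ) ∧ ∀ θ, S.IsAdjoint a u θ fun t => Λ t θ := by
  obtain ⟨X, hX, hXe⟩ := hS.exists_continuous_eq_trajectory hinit u
  -- `M` is the time-reversed adjoint flow. The coefficients use the continuous representative `X`,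
  -- since `trajectory` is uncontrolled outside `[0,1]`.
  obtain ⟨M, hM, hMe⟩ := exists_continuous_flow (V := Covec n) (T := Θ)
    (c := fun o t => weight (u (1 - t)) o)
    (G := fun o t l θ => l.comp (fderiv ℝ (fun y => S.column o y θ) (X (1 - t) θ)))
    (fun o => intervalIntegrable_comp_one_sub (intervalIntegrable_weight u.intervalIntegrable o))
    (fun o => by
      have h1 : Continuous fun p : ℝ × Covec n × Θ => X (1 - p.1) p.2.2 :=
        hX.comp (by fun_prop : Continuous fun p : ℝ × Covec n × Θ => (1 - p.1, p.2.2))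
      have h2 : Continuous fun p : ℝ × Covec n × Θ =>
          fderiv ℝ (fun y => S.column o y p.2.2) (X (1 - p.1) p.2.2) :=
        (hC1 o).comp (h1.prodMk (by fun_prop))
      exact Continuous.clm_comp (by fun_prop) h2) hS.nonneg
    (fun o t l m θ => by
      rw [← ContinuousLinearMap.sub_comp, mul_comm]
      exact (ContinuousLinearMap.opNorm_comp_le _ _).trans
        (mul_le_mul_of_nonneg_left (hS.norm_fderiv_le o _ θ) (norm_nonneg _)))
    (x₀ := fun θ => fderiv ℝ (fun y => a y θ) (X 1 θ))
    (by
      have h1 : Continuous fun θ : Θ => X 1 θ :=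
        hX.comp (by fun_prop : Continuous fun θ : Θ => ((1 : ℝ), θ))
      exact ha.comp (h1.prodMk continuous_id))
  have h01 : (1 : ℝ) ∈ Icc (0 : ℝ) 1 := right_mem_Icc.2 zero_le_one
  refine ⟨fun t θ => M (1 - t) θ,
    hM.comp (by fun_prop : Continuous fun p : ℝ × Θ => (1 - p.1, p.2)), fun θ => ?_⟩
  have hXθ : ContinuousOn (fun t => X t θ) (Icc 0 1) :=
    (hX.comp (by fun_prop : Continuous fun t : ℝ => (t, θ))).continuousOn
  have hx : ContinuousOn (S.trajectory u θ) (Icc 0 1) := hXθ.congr (hXe θ)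
  have hMθ : ContinuousOn (fun t => M t θ) (Icc 0 1) :=
    (hM.comp (by fun_prop : Continuous fun t : ℝ => (t, θ))).continuousOn
  have h0 := hMe θ 0 (left_mem_Icc.2 zero_le_one)
  simp only [intervalIntegral.integral_same, add_zero] at h0
  rw [isAdjoint_iff hC1 hx]
  refine ⟨continuousOn_comp_one_sub hMθ, ?_, ?_⟩
  · simp only [sub_self]
    rw [h0, hXe θ 1 h01]
  · have hint : IntervalIntegrable
        (fun s => (M s θ).comp (S.jacobian (X (1 - s) θ) θ (u (1 - s)))) volume 0 1 := by
      have := intervalIntegrable_comp_one_sub (intervalIntegrable_adjoint_rhs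
        u.intervalIntegrable θ hC1 hXθ (continuousOn_comp_one_sub hMθ)).neg
      simpa using this
    have heq : ∀ t ∈ Icc (0 : ℝ) 1, M t θ = M 0 θ +
        ∫ s in (0 : ℝ)..t, (M s θ).comp (S.jacobian (X (1 - s) θ) θ (u (1 - s))) := by
      intro t ht
      rw [h0, hMe θ t ht]
      simp_rw [jacobian_eq_sum, ContinuousLinearMap.comp_finsetSum,
        ContinuousLinearMap.comp_smul]
    intro t ht
    have := integral_equation_reverse hint heq t ht
    simp only [sub_sub_cancel] at this
    beta_reduce
    rw [this, sub_zero]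
    congr 1
    refine intervalIntegral.integral_congr fun s hs => ?_
    rw [uIcc_of_le ht.1] at hs
    rw [hXe θ s ⟨hs.1, hs.2.trans ht.2⟩]

theorem LipschitzFields.isAdjoint_adjoint [CompactSpace Θ]
    (hinit : Continuous S.initial) {a : Vec n → Θ → ℝ}
    (hC1 : ∀ o, Continuous fun p : Vec n × Θ => fderiv ℝ (fun y => S.column o y p.2) p.1)
    (ha : Continuous fun p : Vec n × Θ => fderiv ℝ (fun x => a x p.2) p.1) (u : Control k)
    (θ : Θ) : S.IsAdjoint a u θ (S.adjoint a u θ) := by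
  obtain ⟨M, -, hM⟩ := hS.exists_continuous_isAdjoint hinit hC1 ha u
  exact Classical.epsilon_spec (p := fun l => S.IsAdjoint a u θ l) ⟨_, hM θ⟩

end Lipschitz

end AffineEnsemble

end EnsembleControl

namespace EnsembleControl

/-! ### Differentiation at zero and integration by parts -/

section Calculus

variable {E F : Type*} [NormedAddCommGroup E] [NormedSpace ℝ E] [NormedAddCommGroup F]
  [NormedSpace ℝ F]

/-- Differentiation under the integral sign at `0`, for real-valued functions whose increments
from `0` are dominated. -/
theorem hasDerivAt_integral_of_norm_sub_le {α : Type*} [MeasurableSpace α] {μ : Measure α}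
    {f : ℝ → α → ℝ} {f' bound : α → ℝ}
    (hf : ∀ ε ∈ Icc (-1 : ℝ) 1, AEStronglyMeasurable (f ε) μ) (hf0 : Integrable (f 0) μ)
    (hf' : AEStronglyMeasurable f' μ)
    (hlip : ∀ᵐ x ∂μ, ∀ ε ∈ Icc (-1 : ℝ) 1, ‖f ε x - f 0 x‖ ≤ bound x * |ε|)
    (hbound : Integrable bound μ) (hdiff : ∀ᵐ x ∂μ, HasDerivAt (f · x) (f' x) 0) :
    HasDerivAt (fun ε => ∫ x, f ε x ∂μ) (∫ x, f' x ∂μ) 0 := by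
  -- `T` sends a number `c` to the map `h ↦ h * c`. This gives access to the Fréchet theorem that
  -- needs domination only of increments from the base point.
  set T : ℝ →L[ℝ] ℝ →L[ℝ] ℝ := ContinuousLinearMap.smulRightL ℝ ℝ ℝ 1
  have hm : AEStronglyMeasurable (T ∘ f') μ := T.continuous.comp_aestronglyMeasurable hf'
  obtain ⟨h1, key⟩ := hasFDerivAt_integral_of_dominated_loc_of_lip' (𝕜 := ℝ)
    (Icc_mem_nhds (by norm_num : (-1 : ℝ) < 0) one_pos) hf hf0 hm
    (by simpa using hlip) hbound (hdiff.mono fun x hx => hx.hasFDerivAt)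
  have hi : Integrable f' μ := by
    rw [← integrable_norm_iff hm] at h1
    rw [← integrable_norm_iff hf']
    simpa [T, (· ∘ ·)] using! h1
  rw [hasDerivAt_iff_hasFDerivAt]
  simpa only [(· ∘ ·), ContinuousLinearMap.integral_comp_comm _ hi] using! key

omit [NormedSpace ℝ E] in
theorem isBigO_sub_of_norm_sub_le {y : ℝ → E} {x : E} {C : ℝ}
    (hy : ∀ ε : ℝ, |ε| ≤ 1 → ‖y ε - x‖ ≤ C * |ε|) :
    (fun ε => y ε - x) =O[𝓝 0] fun ε : ℝ => ε := by
  refine IsBigO.of_bound C ?_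
  filter_upwards [Icc_mem_nhds (by norm_num : (-1 : ℝ) < 0) one_pos] with ε hε
  exact hy ε (abs_le.2 hε)

omit [NormedSpace ℝ E] in
theorem eq_of_norm_sub_le {y : ℝ → E} {x : E} {C : ℝ}
    (hy : ∀ ε : ℝ, |ε| ≤ 1 → ‖y ε - x‖ ≤ C * |ε|) : y 0 = x := by
  have := hy 0 (by simp)
  rw [abs_zero, mul_zero] at this
  exact sub_eq_zero.1 (norm_le_zero_iff.1 this)

/-- The remainder is `o(‖y ε - x‖)`, hence `o(ε)`. Differentiability of `y` is not needed, which is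
why the linearized equation can be avoided. -/
theorem hasDerivAt_taylor_remainder {y : ℝ → E} {x : E} {C : ℝ}
    (hy : ∀ ε : ℝ, |ε| ≤ 1 → ‖y ε - x‖ ≤ C * |ε|) {g : E → F} {g' : E →L[ℝ] F}
    (hg : HasFDerivAt g g' x) : HasDerivAt (fun ε => g (y ε) - g x - g' (y ε - x)) 0 0 := by
  have hO := isBigO_sub_of_norm_sub_le hy
  have hlim : Tendsto y (𝓝 0) (𝓝 x) := by
    have := hO.trans_tendsto tendsto_id
    simpa using this.add_const x
  rw [hasDerivAt_iff_isLittleO]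
  simpa [eq_of_norm_sub_le hy, Function.comp_def] using (hg.isLittleO.comp_tendsto hlim).trans_isBigO hO

/-- The slope between `0` and `ε` is `h ε` itself, so continuity of `h` suffices. -/
theorem hasDerivAt_smul_self_zero {h : ℝ → E} (hh : ContinuousAt h 0) :
    HasDerivAt (fun ε : ℝ => ε • h ε) (h 0) 0 := by
  rw [hasDerivAt_iff_tendsto_slope]
  refine (hh.tendsto.mono_left nhdsWithin_le_nhds).congr' ?_
  filter_upwards [self_mem_nhdsWithin] with ε hε
  simp [slope, smul_smul, inv_mul_cancel₀ (show ε ≠ 0 from hε)]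

/-- Integration by parts for the pairing of an absolutely continuous curve with an absolutely
continuous curve of continuous linear maps. -/
theorem clm_apply_eq_add_integral [CompleteSpace F] {l l' : ℝ → E →L[ℝ] F} {z z' : ℝ → E}
    (hl : AbsolutelyContinuousOnInterval l 0 1) (hz : AbsolutelyContinuousOnInterval z 0 1)
    (hl' : ∀ᵐ t ∂timeMeasure, HasDerivAt l (l' t) t)
    (hz' : ∀ᵐ t ∂timeMeasure, HasDerivAt z (z' t) t)
    (hi : IntervalIntegrable (fun t => l' t (z t) + l t (z' t)) volume 0 1) :
    l 1 (z 1) = l 0 (z 0) + ∫ t in (0 : ℝ)..1, (l' t (z t) + l t (z' t)) := by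
  obtain ⟨A, hA⟩ := hl.exists_bound
  obtain ⟨B, hB⟩ := hz.exists_bound
  have hac : AbsolutelyContinuousOnInterval (fun t => l t (z t)) 0 1 := by
    refine absolutelyContinuousOnInterval_of_dist_le (max A B) hl hz fun s hs t ht => ?_
    have h1 : l s (z s) - l t (z t) = (l s - l t) (z s) + l t (z s - z t) := by simp
    rw [dist_eq_norm, dist_eq_norm, dist_eq_norm, h1, mul_add]
    refine norm_add_le_of_le ?_ ?_
    · rw [mul_comm]
      exact (ContinuousLinearMap.le_opNorm _ _).trans (mul_le_mul_of_nonneg_left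
        ((hB s hs).trans (le_max_right _ _)) (norm_nonneg _))
    · exact (ContinuousLinearMap.le_opNorm _ _).trans (mul_le_mul_of_nonneg_right
        ((hA t ht).trans (le_max_left _ _)) (norm_nonneg _))
  refine (absolutelyContinuous_and_ae_hasDerivAt_iff zero_le_one hi).1 ⟨hac, ?_⟩ 1
    (right_mem_Icc.2 zero_le_one)
  filter_upwards [hl', hz'] with t h1 h2 using h1.clm_apply h2

end Calculus

/-! ### Dependence of trajectories on the control -/

namespace AffineEnsemble

variable {n k d : ℕ} {Θ : Set (Vec d)} {S : AffineEnsemble n k Θ} {L : ℝ}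

theorem velocity_add (S : AffineEnsemble n k Θ) (x : Vec n) (θ : Θ) (v w : Vec k) (ε : ℝ) :
    S.velocity x θ (v + ε • w) = S.velocity x θ v + ε • S.steer x θ w := by
  simp [velocity, steer, add_smul, Finset.sum_add_distrib, Finset.smul_sum, mul_smul, add_assoc]

theorem norm_steer_le {x : Vec n} {θ : Θ} {B : ℝ} (hB : ∀ i, ‖S.fields i x θ‖ ≤ B) (v : Vec k) :
    ‖S.steer x θ v‖ ≤ k * (‖v‖ * B) := by
  have h1 : ‖S.steer x θ v‖ ≤ ∑ _i : Fin k, ‖v‖ * B := by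
    refine norm_sum_le_of_le _ fun i _ => ?_
    rw [norm_smul]
    exact mul_le_mul (PiLp.norm_apply_le v i) (hB i) (norm_nonneg _) (norm_nonneg _)
  simpa using h1

theorem clm_steer_eq_inner (x : Vec n) (θ : Θ) (v : Vec k) (l : Covec n) :
    l (S.steer x θ v) = ⟪S.rowTimesFields x θ l, v⟫ := by
  simp [steer, rowTimesFields, PiLp.inner_apply]

theorem coeFn_add_smul (u v : Control k) (ε : ℝ) :
    ∀ᵐ t ∂timeMeasure, (u + ε • v : Control k) t = u t + ε • v t := by
  filter_upwards [Lp.coeFn_add u (ε • v), Lp.coeFn_smul ε v] with t h1 h2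
  rw [h1, Pi.add_apply, h2, Pi.smul_apply]

variable [CompactSpace Θ] (hS : S.LipschitzFields L) (hinit : Continuous S.initial)
include hS hinit

theorem LipschitzFields.exists_bound_column (u : Control k) :
    ∃ B, 0 ≤ B ∧ ∀ o θ, ∀ t ∈ Icc (0 : ℝ) 1, ‖S.column o (S.trajectory u θ t) θ‖ ≤ B := by
  obtain ⟨X, hX, hXe⟩ := hS.exists_continuous_eq_trajectory hinit u
  have h : ∀ o, ∃ B, ∀ p ∈ Icc (0 : ℝ) 1 ×ˢ (univ : Set Θ), ‖S.column o (X p.1 p.2) p.2‖ ≤ B :=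
    fun o => (isCompact_Icc.prod isCompact_univ).exists_bound_of_continuousOn
      ((hS.continuous o).comp (hX.prodMk continuous_snd)).continuousOn
  choose B hB using h
  refine ⟨∑ o, |B o|, Finset.sum_nonneg fun _ _ => abs_nonneg _, fun o θ t ht => ?_⟩
  rw [hXe θ t ht]
  exact (hB o (t, θ) ⟨ht, mem_univ _⟩).trans ((le_abs_self _).trans
    (Finset.single_le_sum (f := fun o => |B o|) (fun _ _ => abs_nonneg _) (Finset.mem_univ o)))

theorem LipschitzFields.continuousOn_trajectory (u : Control k) (θ : Θ) :
    ContinuousOn (S.trajectory u θ) (Icc 0 1) :=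
  ((hS.isTrajectory_iff u θ _).1 (hS.isTrajectory_trajectory hinit u θ)).1

/-- The trajectories are Lipschitz functions of the control along lines, uniformly in `(t, θ)`. -/
theorem LipschitzFields.exists_norm_trajectory_sub_le (u v : Control k) :
    ∃ C, 0 ≤ C ∧ ∀ ε : ℝ, |ε| ≤ 1 → ∀ θ, ∀ t ∈ Icc (0 : ℝ) 1,
      ‖S.trajectory (u + ε • v) θ t - S.trajectory u θ t‖ ≤ C * |ε| := by
  obtain ⟨B, hB0, hB⟩ := hS.exists_bound_column hinit u
  have hu := u.intervalIntegrable
  have hv := v.intervalIntegrable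
  -- For `|ε| ≤ 1` the sum `‖u s‖ + ‖v s‖` bounds the perturbed control, so one Grönwall constant
  -- serves all `ε` and `θ`.
  have hℓ : IntervalIntegrable (fun s => (k + 1) * (1 + (‖u s‖ + ‖v s‖)) * L) volume 0 1 :=
    ((intervalIntegrable_const.add (hu.norm.add hv.norm)).const_mul _).mul_const _
  have hr : IntervalIntegrable (fun s => k * (‖v s‖ * B)) volume 0 1 :=
    (hv.norm.mul_const _).const_mul _
  obtain ⟨K, hK0, hK⟩ := exists_gronwall_constant hℓ
    (fun s => mul_nonneg (by positivity) hS.nonneg)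
  refine ⟨K * ∫ s in (0 : ℝ)..1, k * (‖v s‖ * B), mul_nonneg hK0
    (intervalIntegral.integral_nonneg zero_le_one fun s _ => by positivity),
    fun ε hε θ => ?_⟩
  obtain ⟨hx1, hx2, hx3⟩ := (hS.isTrajectory_iff _ θ _).1 (hS.isTrajectory_trajectory hinit u θ)
  obtain ⟨hy1, hy2, hy3⟩ := (hS.isTrajectory_iff _ θ _).1
    (hS.isTrajectory_trajectory hinit (u + ε • v) θ)
  have key := norm_sub_le_of_integral_equation (r := fun s => |ε| * (k * (‖v s‖ * B)))
    (C := |ε| * ∫ s in (0 : ℝ)..1, k * (‖v s‖ * B)) hK hℓ (hr.const_mul _)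
    (fun s => by positivity) (by rw [intervalIntegral.integral_const_mul]) hy1 hx1
    (hS.intervalIntegrable_velocity (u + ε • v).intervalIntegrable hy1 θ)
    (hS.intervalIntegrable_velocity hu hx1 θ) hy3 hx3 (hy2.trans hx2.symm) (by
      filter_upwards [coeFn_add_smul u v ε, ae_restrict_mem measurableSet_Icc] with s hs hsm
      -- Change the state first and the control second: the control term is then evaluated on the
      -- unperturbed trajectory, where `B` bounds the fields.
      rw [hs, ← sub_add_sub_cancel _ (S.velocity (S.trajectory u θ s) θ (u s + ε • v s)) _]
      refine norm_add_le_of_le ((hS.norm_velocity_sub_le _ _ θ _).trans ?_) ?_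
      · have h1 : ‖u s + ε • v s‖ ≤ ‖u s‖ + ‖v s‖ := by
          refine norm_add_le_of_le le_rfl ?_
          rw [norm_smul, Real.norm_eq_abs]
          exact mul_le_of_le_one_left (norm_nonneg _) hε
        have := hS.nonneg
        gcongr
      · rw [velocity_add, add_sub_cancel_left, norm_smul, Real.norm_eq_abs]
        exact mul_le_mul_of_nonneg_left (norm_steer_le (fun i => hB (some i) θ s hsm) _)
          (abs_nonneg _))
  intro t ht
  refine (key t ht).trans_eq ?_
  ring

end AffineEnsemble

end EnsembleControl

/-! ### First variation of the terminal cost -/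

namespace EnsembleControl
namespace AffineEnsemble

variable {n k d : ℕ} {Θ : Set (Vec d)} {S : AffineEnsemble n k Θ} {L : ℝ}

/-- The increment of the velocity between `(x, v)` and `(y, v + ε w)`, with the linear part in
`y - x` removed. -/
theorem velocity_increment_eq (S : AffineEnsemble n k Θ) (x y : Vec n) (θ : Θ) (v w : Vec k)
    (ε : ℝ) :
    S.velocity y θ (v + ε • w) - S.velocity x θ v - S.jacobian x θ v (y - x) =
      (∑ o, weight v o • (S.column o y θ - S.column o x θ -
        fderiv ℝ (fun z => S.column o z θ) x (y - x))) + ε • S.steer y θ w := by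
  rw [velocity_add, velocity_eq_sum, velocity_eq_sum, jacobian_eq_sum]
  simp only [_root_.sum_apply, _root_.smul_apply, smul_sub,
    Finset.sum_sub_distrib]
  abel

section

variable (hS : S.LipschitzFields L)
include hS

/-- Supplies the dominating function. The increment of each column and its linear part are each at
most `L * ‖y - x‖`, whence the factor `2`; the columns at `y` are bounded by `B + L * C`. -/
theorem LipschitzFields.norm_velocity_increment_le {x y : Vec n} {θ : Θ} {B C ε : ℝ}
    (hB : ∀ o, ‖S.column o x θ‖ ≤ B) (hy : ‖y - x‖ ≤ C * |ε|) (hC : 0 ≤ C) (hε : |ε| ≤ 1)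
    (v w : Vec k) :
    ‖S.velocity y θ (v + ε • w) - S.velocity x θ v - S.jacobian x θ v (y - x)‖ ≤
      ((k + 1) * (1 + ‖v‖) * (2 * L * C) + k * (‖w‖ * (B + L * C))) * |ε| := by
  have hL := hS.nonneg
  have hLC : L * ‖y - x‖ ≤ L * (C * |ε|) := mul_le_mul_of_nonneg_left hy hL
  have hB' : ∀ o, ‖S.column o y θ‖ ≤ B + L * C := fun o => by
    have h1 := hS.le_state o y x θ
    have h2 := norm_le_norm_add_norm_sub' (S.column o y θ) (S.column o x θ)
    have h3 : L * (C * |ε|) ≤ L * C :=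
      mul_le_mul_of_nonneg_left (mul_le_of_le_one_right hC hε) hL
    linarith [hB o]
  rw [velocity_increment_eq]
  have h1 := norm_sum_weight_smul_le v (C := 2 * L * (C * |ε|))
    (g := fun o => S.column o y θ - S.column o x θ -
        fderiv ℝ (fun z => S.column o z θ) x (y - x)) fun o => by
      have h2 := (ContinuousLinearMap.le_opNorm (fderiv ℝ (fun z => S.column o z θ) x)
        (y - x)).trans (mul_le_mul_of_nonneg_right (hS.norm_fderiv_le o x θ) (norm_nonneg _))
      have h3 := hS.le_state o y x θ
      exact (norm_sub_le _ _).trans (by linarith)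
  have h2 : ‖ε • S.steer y θ w‖ ≤ |ε| * (k * (‖w‖ * (B + L * C))) := by
    rw [norm_smul, Real.norm_eq_abs]
    exact mul_le_mul_of_nonneg_left (norm_steer_le (fun i => hB' (some i)) w) (abs_nonneg _)
  refine (norm_add_le_of_le h1 h2).trans_eq ?_
  ring

/-- The Taylor remainders have zero derivative, so only the control term survives, and it needs only
continuity of `y` at `0`. -/
theorem LipschitzFields.hasDerivAt_velocity_increment {y : ℝ → Vec n} {x : Vec n} {θ : Θ} {C : ℝ}
    (hdiff : ∀ o, Differentiable ℝ fun z => S.column o z θ)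
    (hy : ∀ ε : ℝ, |ε| ≤ 1 → ‖y ε - x‖ ≤ C * |ε|) (v w : Vec k) :
    HasDerivAt (fun ε => S.velocity (y ε) θ (v + ε • w) - S.velocity x θ v -
      S.jacobian x θ v (y ε - x)) (S.steer x θ w) 0 := by
  simp_rw [velocity_increment_eq]
  have hlim : ContinuousAt y 0 := by
    have := (isBigO_sub_of_norm_sub_le hy).trans_tendsto tendsto_id
    simpa [ContinuousAt, eq_of_norm_sub_le hy] using this.add_const x
  have h1 : HasDerivAt (fun ε => ∑ o, weight v o • (S.column o (y ε) θ - S.column o x θ -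
        fderiv ℝ (fun z => S.column o z θ) x (y ε - x))) (∑ o, weight v o • (0 : Vec n)) 0 :=
    HasDerivAt.fun_sum fun o _ =>
      (hasDerivAt_taylor_remainder hy (hdiff o x).hasFDerivAt).fun_const_smul _
  have h2 : ContinuousAt (fun ε => S.steer (y ε) θ w) 0 := by
    have : Continuous fun z => S.steer z θ w := by
      simp only [steer]
      have hcol : ∀ i, Continuous fun z => S.fields i z θ := fun i =>
        (hS.continuous (some i)).comp (continuous_id.prodMk continuous_const)
      fun_prop
    exact this.continuousAt.comp hlim
  have h3 := h1.add (hasDerivAt_smul_self_zero h2)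
  simpa [eq_of_norm_sub_le hy] using! h3

theorem LipschitzFields.intervalIntegrable_clm_increment {u v : ℝ → Vec k}
    (hu : IntervalIntegrable u volume 0 1) (hv : IntervalIntegrable v volume 0 1) {θ : Θ}
    (hC1 : ∀ o, Continuous fun p : Vec n × Θ => fderiv ℝ (fun y => S.column o y p.2) p.1)
    {x y : ℝ → Vec n} (hx : ContinuousOn x (Icc 0 1)) (hy : ContinuousOn y (Icc 0 1))
    {l : ℝ → Covec n} (hl : ContinuousOn l (Icc 0 1)) :
    IntervalIntegrable (fun s => l s (S.velocity (y s) θ (v s) - S.velocity (x s) θ (u s) -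
      S.jacobian (x s) θ (u s) (y s - x s))) volume 0 1 := by
  have hcol : ∀ o {z : ℝ → Vec n}, ContinuousOn z (Icc 0 1) →
      ContinuousOn (fun s => S.column o (z s) θ) (Icc 0 1) := fun o z hz =>
    (hS.continuous o).comp_continuousOn (hz.prodMk continuousOn_const)
  have h1 := intervalIntegrable_sum_weight_smul hv fun o => hl.clm_apply (hcol o hy)
  have h2 := intervalIntegrable_sum_weight_smul hu fun o => hl.clm_apply (hcol o hx)
  have h3 := intervalIntegrable_sum_weight_smul hu fun o => hl.clm_apply
    (((hC1 o).comp_continuousOn (hx.prodMk (continuousOn_const (c := θ)))).clm_apply (hy.sub hx))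
  refine ((h1.sub h2).sub h3).congr fun s _ => ?_
  simp [velocity_eq_sum, jacobian_eq_sum, map_sum]

end

variable [CompactSpace Θ] (hS : S.LipschitzFields L) (hinit : Continuous S.initial)
  {a : Vec n → Θ → ℝ}
  (hC1 : ∀ o, Continuous fun p : Vec n × Θ => fderiv ℝ (fun y => S.column o y p.2) p.1)
  (ha : Continuous fun p : Vec n × Θ => fderiv ℝ (fun x => a x p.2) p.1)
include hS hinit hC1 ha

/-- The adjoint curve transports the terminal increment of a perturbed trajectory. -/
theorem LipschitzFields.adjoint_terminal_increment (u v : Control k) (θ : Θ) (ε : ℝ) :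
    fderiv ℝ (fun y => a y θ) (S.trajectory u θ 1)
      (S.trajectory (u + ε • v) θ 1 - S.trajectory u θ 1) =
    ∫ s in (0 : ℝ)..1, S.adjoint a u θ s
      (S.velocity (S.trajectory (u + ε • v) θ s) θ (u s + ε • v s) -
        S.velocity (S.trajectory u θ s) θ (u s) -
        S.jacobian (S.trajectory u θ s) θ (u s)
          (S.trajectory (u + ε • v) θ s - S.trajectory u θ s)) := by
  have hx := hS.isTrajectory_trajectory hinit u θ
  have hy := hS.isTrajectory_trajectory hinit (u + ε • v) θ
  have hl := hS.isAdjoint_adjoint hinit hC1 ha u θ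
  have hxc := hS.continuousOn_trajectory hinit u θ
  have hyc := hS.continuousOn_trajectory hinit (u + ε • v) θ
  have hlc := ((isAdjoint_iff hC1 hxc _).1 hl).1
  have hint := hS.intervalIntegrable_clm_increment (θ := θ) u.intervalIntegrable
    (u.intervalIntegrable.add (v.intervalIntegrable.smul ε)) hC1 hxc hyc hlc
  have hderiv : ∀ᵐ t ∂timeMeasure, HasDerivAt
      (S.trajectory (u + ε • v) θ - S.trajectory u θ)
      (S.velocity (S.trajectory (u + ε • v) θ t) θ (u t + ε • v t) -
        S.velocity (S.trajectory u θ t) θ (u t)) t := by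
    filter_upwards [hx.2.2, hy.2.2, coeFn_add_smul u v ε] with t h1 h2 h3
    rw [← h3]
    exact h2.sub h1
  -- The adjoint equation contributes `-Λ J (y - x)`, exactly the linear part removed from the
  -- increment; the boundary term at `0` vanishes because the initial states agree.
  have key := clm_apply_eq_add_integral hl.1 (hy.1.sub hx.1) hl.2.2 hderiv
    (hint.congr fun s _ => by simp; ring)
  rw [hl.2.1] at key
  simp only [Pi.sub_apply] at key
  rw [key, hx.2.1, hy.2.1, sub_self, map_zero, zero_add]
  refine intervalIntegral.integral_congr fun s _ => ?_
  simp
  ring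

variable (hdiff : ∀ o θ, Differentiable ℝ fun x => S.column o x θ)
  (hadiff : ∀ θ, Differentiable ℝ fun x => a x θ)
include hdiff hadiff

/-- The first variation of the terminal cost, for one value of the parameter. -/
theorem LipschitzFields.hasDerivAt_terminal_cost (u v : Control k) (θ : Θ) :
    HasDerivAt (fun ε : ℝ => a (S.trajectory (u + ε • v) θ 1) θ)
      (∫ s in (0 : ℝ)..1, S.adjoint a u θ s (S.steer (S.trajectory u θ s) θ (v s))) 0 := by
  obtain ⟨C, hC0, hC⟩ := hS.exists_norm_trajectory_sub_le hinit u v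
  obtain ⟨B, hB0, hB⟩ := hS.exists_bound_column hinit u
  have h01 : (1 : ℝ) ∈ Icc (0 : ℝ) 1 := right_mem_Icc.2 zero_le_one
  have hxc := hS.continuousOn_trajectory hinit u θ
  have hlc := ((isAdjoint_iff hC1 hxc _).1 (hS.isAdjoint_adjoint hinit hC1 ha u θ)).1
  obtain ⟨A, hA⟩ := isCompact_Icc.exists_bound_of_continuousOn hlc
  have hint := fun ε : ℝ => hS.intervalIntegrable_clm_increment (θ := θ) u.intervalIntegrable
    (u.intervalIntegrable.add (v.intervalIntegrable.smul ε)) hC1 hxc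
    (hS.continuousOn_trajectory hinit (u + ε • v) θ) hlc
  have h1 : HasDerivAt (fun ε : ℝ => fderiv ℝ (fun y => a y θ) (S.trajectory u θ 1)
      (S.trajectory (u + ε • v) θ 1 - S.trajectory u θ 1))
      (∫ s in (0 : ℝ)..1, S.adjoint a u θ s (S.steer (S.trajectory u θ s) θ (v s))) 0 := by
    simp_rw [hS.adjoint_terminal_increment hinit hC1 ha u v θ]
    simp only [intervalIntegral.integral_of_le (zero_le_one (α := ℝ))]
    have hmem : ∀ᵐ s ∂volume.restrict (Ioc (0 : ℝ) 1), s ∈ Icc (0 : ℝ) 1 :=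
      (ae_restrict_mem measurableSet_Ioc).mono fun s hs => Ioc_subset_Icc_self hs
    have hd : ∀ s ∈ Icc (0 : ℝ) 1, HasDerivAt (fun ε : ℝ => S.adjoint a u θ s
        (S.velocity (S.trajectory (u + ε • v) θ s) θ (u s + ε • v s) -
          S.velocity (S.trajectory u θ s) θ (u s) -
          S.jacobian (S.trajectory u θ s) θ (u s)
            (S.trajectory (u + ε • v) θ s - S.trajectory u θ s)))
        (S.adjoint a u θ s (S.steer (S.trajectory u θ s) θ (v s))) 0 := fun s hs =>
      (S.adjoint a u θ s).hasFDerivAt.comp_hasDerivAt 0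
        (hS.hasDerivAt_velocity_increment (fun o => hdiff o θ) (fun ε hε => hC ε hε θ s hs)
          (u s) (v s))
    have hzero : ∀ s, S.adjoint a u θ s
        (S.velocity (S.trajectory (u + (0 : ℝ) • v) θ s) θ (u s + (0 : ℝ) • v s) -
          S.velocity (S.trajectory u θ s) θ (u s) -
          S.jacobian (S.trajectory u θ s) θ (u s)
            (S.trajectory (u + (0 : ℝ) • v) θ s - S.trajectory u θ s)) = 0 := fun s => by simp
    have hsteer : IntervalIntegrable
        (fun s => S.adjoint a u θ s (S.steer (S.trajectory u θ s) θ (v s))) volume 0 1 := by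
      -- The weighted sum includes the drift with weight `1`; subtracting the drift leaves the
      -- control term.
      have h3 := intervalIntegrable_sum_weight_smul v.intervalIntegrable
        fun o => hlc.clm_apply ((hS.continuous o).comp_continuousOn
          (hxc.prodMk (continuousOn_const (c := θ))))
      have h4 : ContinuousOn (fun s => S.adjoint a u θ s (S.drift (S.trajectory u θ s) θ))
          (uIcc 0 1) := by
        rw [uIcc_of_le zero_le_one]
        exact hlc.clm_apply ((hS.continuous none).comp_continuousOn
          (hxc.prodMk (continuousOn_const (c := θ))))
      refine (h3.sub h4.intervalIntegrable).congr fun s _ => ?_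
      simp [Fintype.sum_option, weight, column, steer]
    refine hasDerivAt_integral_of_norm_sub_le
      (bound := fun s => A * ((k + 1) * (1 + ‖u s‖) * (2 * L * C) + k * (‖v s‖ * (B + L * C))))
      (fun ε _ => ((hint ε).1).aestronglyMeasurable) ((hint 0).1)
      hsteer.1.aestronglyMeasurable ?_ ?_ (hmem.mono hd)
    · filter_upwards [hmem] with s hs ε hε
      rw [hzero, sub_zero, mul_assoc]
      refine (ContinuousLinearMap.le_opNorm _ _).trans ?_
      exact mul_le_mul (hA s hs) (hS.norm_velocity_increment_le (fun o => hB o θ s hs)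
        (hC ε (abs_le.2 hε) θ s hs) hC0 (abs_le.2 hε) _ _) (norm_nonneg _)
        ((norm_nonneg _).trans (hA s hs))
    · exact ((((intervalIntegrable_growth u.intervalIntegrable _).add
        ((v.intervalIntegrable.norm.mul_const _).const_mul _)).const_mul A)).1
  -- The nonlinear part of the terminal cost has zero derivative, so `h1` carries the whole
  -- variation.
  have h2 := hasDerivAt_taylor_remainder (fun ε hε => hC ε hε θ 1 h01)
    (hadiff θ (S.trajectory u θ 1)).hasFDerivAt
  have h3 := (h2.add h1).add_const (a (S.trajectory u θ 1) θ)
  rw [zero_add] at h3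
  refine h3.congr_of_eventuallyEq (Eventually.of_forall fun ε => ?_)
  simp

end AffineEnsemble

end EnsembleControl

/-! ### Maximizers, gradient of the averaged cost, stationarity -/

namespace EnsembleControl

/-- The function `v ↦ -⟪w, v⟫ - β/2 |v|²` has exactly one maximizer. -/
theorem isMaxOn_neg_inner_sub_iff {E : Type*} [NormedAddCommGroup E] [InnerProductSpace ℝ E]
    {β : ℝ} (hβ : 0 < β) (w v : E) :
    IsMaxOn (fun v : E => -⟪w, v⟫ - β / 2 * ‖v‖ ^ 2) univ v ↔ v = -(1 / β) • w := by
  -- Completion of the square around `-(1 / β) • w`.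
  have hsq : ∀ v : E, -⟪w, v⟫ - β / 2 * ‖v‖ ^ 2 =
      1 / (2 * β) * ‖w‖ ^ 2 - β / 2 * ‖v - -(1 / β) • w‖ ^ 2 := fun v => by
    rw [neg_smul, sub_neg_eq_add, norm_add_sq_real, inner_smul_right, norm_smul, mul_pow,
      real_inner_comm, Real.norm_eq_abs, sq_abs]
    field_simp
    ring
  simp_rw [isMaxOn_iff, hsq]
  constructor
  · intro h
    have h1 := h (-(1 / β) • w) (mem_univ _)
    rw [sub_self, norm_zero] at h1
    have h2 : ‖v - -(1 / β) • w‖ ^ 2 ≤ 0 := by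
      by_contra! hcon
      have := mul_pos (half_pos hβ) hcon
      linarith
    exact sub_eq_zero.1 (norm_eq_zero.1 (pow_eq_zero_iff two_ne_zero |>.1
      (le_antisymm h2 (sq_nonneg _))))
  · rintro rfl y -
    rw [sub_self, norm_zero]
    have := mul_nonneg (half_pos hβ).le (sq_nonneg ‖y - -(1 / β) • w‖)
    linarith

namespace AffineEnsemble

variable {n k d : ℕ} {Θ : Set (Vec d)} {S : AffineEnsemble n k Θ} {L : ℝ}
  [CompactSpace Θ] (hS : S.LipschitzFields L) (hinit : Continuous S.initial)
  {a : Vec n → Θ → ℝ}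
include hS hinit

theorem LipschitzFields.continuous_trajectory_apply (u : Control k) {t : ℝ}
    (ht : t ∈ Icc (0 : ℝ) 1) : Continuous fun θ => S.trajectory u θ t := by
  obtain ⟨X, hX, hXe⟩ := hS.exists_continuous_eq_trajectory hinit u
  simp_rw [fun θ => hXe θ t ht]
  exact hX.comp (by fun_prop : Continuous fun θ : Θ => (t, θ))

theorem LipschitzFields.integrable_terminal_cost
    (hac : Continuous fun p : Vec n × Θ => a p.1 p.2) (μ : Measure Θ) [IsProbabilityMeasure μ]
    (u : Control k) : Integrable (fun θ => a (S.trajectory u θ 1) θ) μ :=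
  (hac.comp ((hS.continuous_trajectory_apply hinit u (right_mem_Icc.2 zero_le_one)).prodMk
    continuous_id)).integrable_of_hasCompactSupport (HasCompactSupport.of_compactSpace _)

variable (hC1 : ∀ o, Continuous fun p : Vec n × Θ => fderiv ℝ (fun y => S.column o y p.2) p.1)
  (ha : Continuous fun p : Vec n × Θ => fderiv ℝ (fun x => a x p.2) p.1)
include ha

/-- Terminal costs are Lipschitz functions of the control along lines, uniformly in `θ`. -/
theorem LipschitzFields.exists_abs_terminal_cost_sub_le
    (hadiff : ∀ θ, Differentiable ℝ fun x => a x θ) (u v : Control k) :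
    ∃ C, ∀ ε : ℝ, |ε| ≤ 1 → ∀ θ,
      ‖a (S.trajectory (u + ε • v) θ 1) θ - a (S.trajectory u θ 1) θ‖ ≤ C * |ε| := by
  obtain ⟨C, hC0, hC⟩ := hS.exists_norm_trajectory_sub_le hinit u v
  have h01 : (1 : ℝ) ∈ Icc (0 : ℝ) 1 := right_mem_Icc.2 zero_le_one
  obtain ⟨R, hR⟩ := isCompact_univ.exists_bound_of_continuousOn
    (hS.continuous_trajectory_apply hinit u h01).continuousOn
  -- `R` bounds the unperturbed endpoints and `C` their displacement, so this convex ball contains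
  -- both endpoints and the mean value inequality applies with one constant for all `θ`.
  obtain ⟨A, hA⟩ := ((isCompact_closedBall (0 : Vec n) (R + C)).prod
    (isCompact_univ (X := Θ))).exists_bound_of_continuousOn ha.continuousOn
  refine ⟨A * C, fun ε hε θ => ?_⟩
  have hCε := mul_le_of_le_one_right hC0 hε
  have hx := hR θ (mem_univ _)
  have hxy := hC ε hε θ 1 h01
  have hx' : S.trajectory u θ 1 ∈ Metric.closedBall (0 : Vec n) (R + C) := by
    rw [mem_closedBall_zero_iff]
    linarith
  have hy' : S.trajectory (u + ε • v) θ 1 ∈ Metric.closedBall (0 : Vec n) (R + C) := by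
    rw [mem_closedBall_zero_iff]
    linarith [norm_le_norm_add_norm_sub' (S.trajectory (u + ε • v) θ 1) (S.trajectory u θ 1)]
  have hA0 : 0 ≤ A := (norm_nonneg _).trans (hA (S.trajectory u θ 1, θ) ⟨hx', mem_univ _⟩)
  refine ((convex_closedBall (0 : Vec n) (R + C)).norm_image_sub_le_of_norm_fderiv_le (𝕜 := ℝ)
    (fun z _ => hadiff θ z) (fun z hz => hA (z, θ) ⟨hz, mem_univ _⟩) hx' hy').trans ?_
  rw [mul_assoc]
  exact mul_le_mul_of_nonneg_left hxy hA0

include hC1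

/-- The row vectors `Λ F` depend continuously on `(t, θ)`, up to a bounded extension in time. -/
theorem LipschitzFields.exists_continuous_eq_rowTimesFields (u : Control k) :
    ∃ (R : ℝ → Θ → Vec k) (B : ℝ), Continuous (uncurry R) ∧ (∀ t θ, ‖R t θ‖ ≤ B) ∧
      ∀ θ, ∀ t ∈ Icc (0 : ℝ) 1,
        S.rowTimesFields (S.trajectory u θ t) θ (S.adjoint a u θ t) = R t θ := by
  obtain ⟨X, hX, hXe⟩ := hS.exists_continuous_eq_trajectory hinit u
  obtain ⟨M, hM, hMa⟩ := hS.exists_continuous_isAdjoint hinit hC1 ha u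
  have hMe : ∀ θ, ∀ t ∈ Icc (0 : ℝ) 1, S.adjoint a u θ t = M t θ := fun θ =>
    hS.isAdjoint_eqOn hC1 (hS.continuousOn_trajectory hinit u θ)
      (hS.isAdjoint_adjoint hinit hC1 ha u θ) (hMa θ)
  have h01 : (0 : ℝ) ≤ 1 := zero_le_one
  have hrow : Continuous fun p : ℝ × Θ => S.rowTimesFields (X p.1 p.2) p.2 (M p.1 p.2) := by
    refine (PiLp.continuous_toLp 2 _).comp (continuous_pi fun i => ?_)
    exact hM.clm_apply ((hS.continuous (some i)).comp (hX.prodMk continuous_snd))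
  obtain ⟨B, hB⟩ := (isCompact_Icc.prod (isCompact_univ (X := Θ))).exists_bound_of_continuousOn
    (hrow.continuousOn (s := Icc (0 : ℝ) 1 ×ˢ univ))
  -- Clamping time to `[0,1]` keeps continuity and turns the bound on a compact set into a global
  -- one.
  refine ⟨fun t θ => S.rowTimesFields (X (projIcc 0 1 h01 t) θ) θ (M (projIcc 0 1 h01 t) θ), B,
    hrow.comp (f := fun p : ℝ × Θ => ((projIcc 0 1 h01 p.1 : ℝ), p.2)) ?_,
    fun t θ => hB ((projIcc 0 1 h01 t : ℝ), θ) ⟨(projIcc 0 1 h01 t).2, mem_univ _⟩,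
    fun θ t ht => ?_⟩
  · exact (continuous_subtype_val.comp (continuous_projIcc.comp continuous_fst)).prodMk
      continuous_snd
  · beta_reduce
    rw [projIcc_of_mem h01 ht, hXe θ t ht, hMe θ t ht]

theorem LipschitzFields.integrable_rowTimesFields (μ : Measure Θ) [IsProbabilityMeasure μ]
    (u : Control k) {t : ℝ} (ht : t ∈ Icc (0 : ℝ) 1) :
    Integrable (fun θ => S.rowTimesFields (S.trajectory u θ t) θ (S.adjoint a u θ t)) μ := by
  obtain ⟨R, B, hR, -, hRe⟩ := hS.exists_continuous_eq_rowTimesFields hinit hC1 ha u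
  simp_rw [fun θ => hRe θ t ht]
  exact (hR.comp (by fun_prop : Continuous fun θ : Θ => (t, θ))).integrable_of_hasCompactSupport
    (HasCompactSupport.of_compactSpace _)

/-- Averaging commutes with the pairing with `v`, which exposes a quadratic function of `v`. -/
theorem LipschitzFields.hamiltonian_eq (μ : Measure Θ) [IsProbabilityMeasure μ] (β : ℝ)
    (u : Control k) {t : ℝ} (ht : t ∈ Icc (0 : ℝ) 1) (v : Vec k) :
    S.hamiltonian a μ β u t v =
      -⟪∫ θ, S.rowTimesFields (S.trajectory u θ t) θ (S.adjoint a u θ t) ∂μ, v⟫ -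
        β / 2 * ‖v‖ ^ 2 := by
  simp_rw [hamiltonian, clm_steer_eq_inner, integral_neg]
  rw [real_inner_comm, ← integral_inner (hS.integrable_rowTimesFields hinit hC1 ha μ u ht)]
  simp_rw [real_inner_comm]

theorem LipschitzFields.isMaxOn_hamiltonian_iff (μ : Measure Θ) [IsProbabilityMeasure μ] {β : ℝ}
    (hβ : 0 < β) (u : Control k) {t : ℝ} (ht : t ∈ Icc (0 : ℝ) 1) (w : Vec k) :
    IsMaxOn (S.hamiltonian a μ β u t) univ w ↔ w = S.feedback a μ β u t := by
  rw [funext (hS.hamiltonian_eq hinit hC1 ha μ β u ht), isMaxOn_neg_inner_sub_iff hβ]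
  rfl

variable (hac : Continuous fun p : Vec n × Θ => a p.1 p.2)
  (hdiff : ∀ o θ, Differentiable ℝ fun x => S.column o x θ)
  (hadiff : ∀ θ, Differentiable ℝ fun x => a x θ)
include hac hdiff hadiff

/-- The gradient of the averaged terminal cost is the average of the row vectors `Λ F`. -/
theorem LipschitzFields.exists_gradient_terminal_cost (μ : Measure Θ) [IsProbabilityMeasure μ]
    (u : Control k) :
    ∃ W : Control k,
      (∀ᵐ t ∂timeMeasure,
        W t = ∫ θ, S.rowTimesFields (S.trajectory u θ t) θ (S.adjoint a u θ t) ∂μ) ∧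
      ∀ v : Control k, HasDerivAt
        (fun ε : ℝ => ∫ θ, a (S.trajectory (u + ε • v) θ 1) θ ∂μ) ⟪W, v⟫ 0 := by
  obtain ⟨R, B, hR, hRB, hRe⟩ := hS.exists_continuous_eq_rowTimesFields hinit hC1 ha u
  have hRm : AEStronglyMeasurable (uncurry R) (timeMeasure.prod μ) :=
    hR.aestronglyMeasurable
  -- A bounded measurable function on a finite measure space is square integrable, so the averaged
  -- row vector is an admissible direction.
  have hw : MemLp (fun t => ∫ θ, R t θ ∂μ) 2 timeMeasure := by
    refine MemLp.of_bound hRm.integral_prod_right' B (Eventually.of_forall fun t => ?_)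
    simpa using norm_integral_le_of_norm_le_const (μ := μ) (Eventually.of_forall (hRB t))
  refine ⟨hw.toLp, ?_, fun v => ?_⟩
  · filter_upwards [hw.coeFn_toLp, ae_restrict_mem measurableSet_Icc] with t h1 h2
    rw [h1]
    exact integral_congr_ae (Eventually.of_forall fun θ => (hRe θ t h2).symm)
  · have hvi : Integrable v timeMeasure := (Lp.memLp v).integrable (by norm_num)
    have hprod : Integrable (uncurry fun t θ => ⟪R t θ, v t⟫) (timeMeasure.prod μ) := by
      have h1 := hvi.comp_fst μ
      refine (h1.norm.const_mul B).mono' (hRm.inner h1.aestronglyMeasurable)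
        (Eventually.of_forall fun p => ?_)
      exact (norm_inner_le_norm _ _).trans (mul_le_mul_of_nonneg_right (hRB _ _) (norm_nonneg _))
    have hD : ∀ θ, ∫ s in (0 : ℝ)..1,
        S.adjoint a u θ s (S.steer (S.trajectory u θ s) θ (v s)) =
          ∫ t, ⟪R t θ, v t⟫ ∂timeMeasure := fun θ => by
      rw [intervalIntegral.integral_of_le zero_le_one, ← integral_Icc_eq_integral_Ioc]
      refine integral_congr_ae ?_
      filter_upwards [ae_restrict_mem measurableSet_Icc] with t ht
      rw [clm_steer_eq_inner, hRe θ t ht]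
    -- Fubini's theorem: the average over `Θ` of the first variations is an `L²` pairing in time.
    have hinner : ⟪hw.toLp, v⟫ = ∫ θ, ∫ t, ⟪R t θ, v t⟫ ∂timeMeasure ∂μ := by
      rw [← integral_integral_swap hprod, L2.inner_def]
      refine integral_congr_ae ?_
      filter_upwards [hw.coeFn_toLp] with t ht
      have hi : Integrable (fun θ => R t θ) μ :=
        (hR.comp (by fun_prop : Continuous fun θ : Θ => (t, θ))).integrable_of_hasCompactSupport
          (HasCompactSupport.of_compactSpace _)
      rw [ht, real_inner_comm, ← integral_inner hi]
      simp_rw [real_inner_comm]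
    obtain ⟨C, hC⟩ := hS.exists_abs_terminal_cost_sub_le hinit ha hadiff u v
    rw [hinner]
    refine hasDerivAt_integral_of_norm_sub_le (bound := fun _ => C)
      (fun ε _ => (hS.integrable_terminal_cost hinit hac μ _).aestronglyMeasurable)
      (hS.integrable_terminal_cost hinit hac μ _)
      hprod.integral_prod_right.aestronglyMeasurable
      (Eventually.of_forall fun θ ε hε => ?_) (integrable_const C)
      (Eventually.of_forall fun θ => ?_)
    · simpa using hC ε (abs_le.2 hε) θ
    · rw [← hD]
      exact hS.hasDerivAt_terminal_cost hinit hC1 ha hdiff hadiff u v θ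

/-- The stationarity condition at a local minimizer. -/
theorem LipschitzFields.ae_eq_feedback (μ : Measure Θ) [IsProbabilityMeasure μ] {β : ℝ}
    (hβ : 0 < β) {u : Control k} (hmin : IsLocalMin (S.cost a μ β) u) :
    ∀ᵐ t ∂timeMeasure, u t = S.feedback a μ β u t := by
  obtain ⟨W, hW, hWd⟩ := hS.exists_gradient_terminal_cost hinit hC1 ha hac hdiff hadiff μ u
  have hcrit : ∀ v : Control k, ⟪W + β • u, v⟫ = 0 := fun v => by
    have hline : HasDerivAt (fun ε : ℝ => u + ε • v) v 0 := by
      simpa using! ((hasDerivAt_id (0 : ℝ)).smul_const v).const_add u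
    have hcost : HasDerivAt (fun ε : ℝ => S.cost a μ β (u + ε • v))
        (⟪W, v⟫ + β / 2 * (2 * ⟪u, v⟫)) 0 := by
      have h1 := hline.norm_sq.const_mul (β / 2)
      rw [zero_smul, add_zero] at h1
      exact (hWd v).add h1
    have hloc : IsLocalMin (fun ε : ℝ => S.cost a μ β (u + ε • v)) 0 := by
      have hc : Tendsto (fun ε : ℝ => u + ε • v) (𝓝 0) (𝓝 u) := by
        simpa using hline.continuousAt.tendsto
      filter_upwards [hc.eventually hmin] with ε hε
      simpa using hε
    have h0 := hloc.hasDerivAt_eq_zero hcost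
    rw [inner_add_left, real_inner_smul_left]
    linarith
  -- The direction tested is `W + β • u` itself.
  have hzero : W + β • u = 0 := inner_self_eq_zero.1 (hcrit _)
  have hu : u = -(1 / β) • W := by
    rw [eq_neg_of_add_eq_zero_left hzero, smul_neg, neg_smul, neg_neg, smul_smul,
      one_div_mul_cancel hβ.ne', one_smul]
  filter_upwards [hW, Lp.coeFn_smul (-(1 / β)) W] with t h1 h2
  rw [feedback, ← h1, ← Pi.smul_apply, ← h2, ← hu]

end AffineEnsemble

end EnsembleControl

theorem mainTheorem1 {n k d : ℕ} {Θ : Set (EnsembleControl.Vec d)} (hΘ : IsCompact Θ)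
    (S : EnsembleControl.AffineEnsemble n k Θ)
    (L : ℝ)
    (hdrift : ∀ (x₁ x₂ : EnsembleControl.Vec n) (θ₁ θ₂ : Θ),
      ‖S.drift x₁ θ₁ - S.drift x₂ θ₂‖ ≤ L * (‖x₁ - x₂‖ + dist θ₁ θ₂))
    (hfields : ∀ (i : Fin k) (x₁ x₂ : EnsembleControl.Vec n) (θ₁ θ₂ : Θ),
      ‖S.fields i x₁ θ₁ - S.fields i x₂ θ₂‖ ≤ L * (‖x₁ - x₂‖ + dist θ₁ θ₂))
    (hinitial : Continuous S.initial)
    (a : EnsembleControl.Vec n → Θ → ℝ)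
    (ha_nonneg : ∀ x θ, 0 ≤ a x θ)
    (ha_cont : Continuous fun p : EnsembleControl.Vec n × Θ => a p.1 p.2)
    (μ : Measure Θ) [IsProbabilityMeasure μ]
    (β : ℝ) (hβ : 0 < β)
    -- `∂F₀/∂x`, `∂Fᵢ/∂x` and `∇ₓ a` exist and are continuous in `(x, θ)`
    (hdrift_diff : ∀ θ, Differentiable ℝ fun x => S.drift x θ)
    (hdrift_C1 : Continuous fun p : EnsembleControl.Vec n × Θ =>
      fderiv ℝ (fun x => S.drift x p.2) p.1)
    (hfields_diff : ∀ i θ, Differentiable ℝ fun x => S.fields i x θ)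
    (hfields_C1 : ∀ i, Continuous fun p : EnsembleControl.Vec n × Θ =>
      fderiv ℝ (fun x => S.fields i x p.2) p.1)
    (ha_diff : ∀ θ, Differentiable ℝ fun x => a x θ)
    (ha_C1 : Continuous fun p : EnsembleControl.Vec n × Θ =>
      fderiv ℝ (fun x => a x p.2) p.1)
    (ubar : EnsembleControl.Control k)
    (hmin : IsLocalMin (S.cost a μ β) ubar) :
    -- the trajectories and the adjoint curves exist, and are unique on `[0,1]`
    (∀ u θ, S.IsTrajectory u θ (S.trajectory u θ) ∧
      ∀ x, S.IsTrajectory u θ x → EqOn x (S.trajectory u θ) (Icc 0 1)) ∧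
    (∀ θ, S.IsAdjoint a ubar θ (S.adjoint a ubar θ) ∧
      ∀ l, S.IsAdjoint a ubar θ l → EqOn l (S.adjoint a ubar θ) (Icc 0 1)) ∧
    -- the integrals in the cost, in the maximized function and in the formula converge
    (∀ u, Integrable (fun θ => a (S.trajectory u θ 1) θ) μ) ∧
    (∀ t ∈ Icc (0 : ℝ) 1, ∀ v, Integrable
      (fun θ => S.adjoint a ubar θ t (S.steer (S.trajectory ubar θ t) θ v)) μ) ∧
    (∀ t ∈ Icc (0 : ℝ) 1, Integrable
      (fun θ => S.rowTimesFields (S.trajectory ubar θ t) θ (S.adjoint a ubar θ t)) μ) ∧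
    -- the maximum principle
    (∀ᵐ t ∂EnsembleControl.timeMeasure,
      IsMaxOn (S.hamiltonian a μ β ubar t) univ (ubar t)) ∧
    -- its equivalent form as an explicit formula
    (∀ t ∈ Icc (0 : ℝ) 1, ∀ w, IsMaxOn (S.hamiltonian a μ β ubar t) univ w ↔
      w = S.feedback a μ β ubar t) ∧
    (∀ᵐ t ∂EnsembleControl.timeMeasure, ubar t = S.feedback a μ β ubar t) := by
  have : CompactSpace Θ := isCompact_iff_compactSpace.1 hΘ
  -- The sign of `L` is not assumed, so its absolute value is used.
  have hS : S.LipschitzFields |L| := by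
    refine ⟨abs_nonneg L, fun o x₁ x₂ θ₁ θ₂ => ?_⟩
    have hL : L * (‖x₁ - x₂‖ + dist θ₁ θ₂) ≤ |L| * (‖x₁ - x₂‖ + dist θ₁ θ₂) :=
      mul_le_mul_of_nonneg_right (le_abs_self L) (by positivity)
    cases o with
    | none => exact (hdrift x₁ x₂ θ₁ θ₂).trans hL
    | some i => exact (hfields i x₁ x₂ θ₁ θ₂).trans hL
  have hC1 : ∀ o, Continuous fun p : EnsembleControl.Vec n × Θ =>
      fderiv ℝ (fun y => S.column o y p.2) p.1 := fun o => by
    cases o with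
    | none => exact hdrift_C1
    | some i => exact hfields_C1 i
  have hdiff : ∀ o θ, Differentiable ℝ fun x => S.column o x θ := fun o θ => by
    cases o with
    | none => exact hdrift_diff θ
    | some i => exact hfields_diff i θ
  have hrow := fun t (ht : t ∈ Icc (0 : ℝ) 1) =>
    hS.integrable_rowTimesFields hinitial hC1 ha_C1 μ ubar ht
  have hmax := fun t (ht : t ∈ Icc (0 : ℝ) 1) =>
    hS.isMaxOn_hamiltonian_iff hinitial hC1 ha_C1 μ hβ ubar ht
  have hfb := hS.ae_eq_feedback hinitial hC1 ha_C1 ha_cont hdiff ha_diff μ hβ hmin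
  refine ⟨fun u θ => ⟨hS.isTrajectory_trajectory hinitial u θ, fun x hx =>
      hS.isTrajectory_eqOn hx (hS.isTrajectory_trajectory hinitial u θ)⟩,
    fun θ => ⟨hS.isAdjoint_adjoint hinitial hC1 ha_C1 ubar θ, fun l hl =>
      hS.isAdjoint_eqOn hC1 (hS.continuousOn_trajectory hinitial ubar θ) hl
        (hS.isAdjoint_adjoint hinitial hC1 ha_C1 ubar θ)⟩,
    hS.integrable_terminal_cost hinitial ha_cont μ, fun t ht v => ?_, hrow, ?_, hmax, hfb⟩
  · simp_rw [EnsembleControl.AffineEnsemble.clm_steer_eq_inner]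
    exact (hrow t ht).inner_const v
  · filter_upwards [hfb, ae_restrict_mem measurableSet_Icc] with t h1 h2
    exact (hmax t h2 _).2 h1
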